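/- **Setting.** Let $\mathbb T$ be the circle, identified with $[-\pi,\pi)$ and equipped with the normalized Lebesgue measure $\mu$; functions on $\mathbb T$ are $2\pi$-periodic functions $\mathbb R\to\mathbb C$. Let $X$ be a Banach function lattice on $\mathbb T$: a Banach space of (Lebesgue) measurable functions, which are finite-valued and defined at every point (functions are not identified when they are equal almost everywhere, and $\|f\|_X=0$ means $f=0$ a.e.), such that 1. if $f$ is measurable, $g\in X$ and $|f|\le|g|$ a.e., then $f\in X$ and $\|f\|_X\le\|g\|_X$; 2. if $f_j\in X$, $\sup_j\|f_j\|_X<\infty$ and $0\le f_j\uparrow f$ a.e., then $f\in X$ and $\|f_j\|_X\to\|f\|_X$; 3. for every measurable $E\subset\mathbb T$, $\chi_E\in X$ and there is $c_E>0$ with $\int_E|f|\,d\mu\le c_E\|f\|_X$ for all $f\in X$. For $h>0$ put $$A_hf(x)=\frac1h\int_{x-h/2}^{x+h/2}f(t)\,dt,\qquad \dot A_hf(x)=A_hf\Big(x+\frac h2\Big).$$ Assume (Assumption A) that $A_hf\in X$ for all $f\in X$ and $h>0$, and $\sup_{h>0,\ \|f\|_X\le1}\|A_hf\|_X<\infty$.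 Let $\mathcal T_n$ be the set of trigonometric polynomials $\sum_{|k|\le n}c_ke^{ikx}$, $c_k\in\mathbb C$. Let $\gamma,\gamma'>0$ and for every integer $n\ge1$ let $m_n\ge1$, let $x_1<\dots<x_{m_n}$ (depending on $n$) be points of $\mathbb T$ with $$\frac{\gamma}{n}\le x_{k+1}-x_k\le\frac{\gamma'}{n},\qquad k=1,\dots,m_n,\qquad x_{m_n+1}:=2\pi+x_1,$$ and let $\varphi_{1,n},\dots,\varphi_{m_n,n}$ be functions on $\mathbb T$. Put $$G_nf(x)=\sum_{k=1}^{m_n}f(x_k)\varphi_{k,n}(x),\qquad \|f\|_{X_n}=\Big\|\sum_{k=1}^{m_n}|f(x_k)|\,\chi_{[x_k,x_{k+1})}\Big\|_X .$$ **Theorem.** Let $r,s\ge1$ be integers with $2r\ge s$. Assume that $G_nf\in\mathcal T_n$ for all $f\in X$ and $n\ge1$, and that there are constants $K_1,K_3,K_4>0$, independent of $f$, $T$ and $n$, such that for all $n\ge1$ $$\|G_nf\|_X\le K_1\|f\|_{X_n}\quad (f\in X),\tag{A1}$$ $$\|T-G_nT\|_X\le K_3n^{-s}\|T^{(s)}\|_X\quad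 (T\in\mathcal T_n),\tag{A3}$$ $$K_4n^{-s}\|T^{(s)}\|_X\le\|T-G_nT\|_X\quad (T\in\mathcal T_n).\tag{A4}$$ Then for all $f\in X$ and $n\ge1$ all norms below are norms of elements of $X$, and there are constants $C_1,C_2>0$, independent of $f$ and $n$, such that for all $f\in X$ and $n\ge1$ $$C_1\Big(\|(I-\dot A_{\gamma/n})^sf\|_X+\|(I-A_{\gamma/n})^rf\|_{X_n}\Big)\le\|f-G_nf\|_X+\|f-G_nf\|_{X_n}\le C_2\Big(\|(I-\dot A_{\gamma/n})^sf\|_X+\|(I-A_{\gamma/n})^rf\|_{X_n}\Big).$$ -/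

import Mathlib

open MeasureTheory Filter Topology Set

/-- Normalized Lebesgue measure on the circle `𝕋`, identified with `[-π, π)`. -/
noncomputable def torusMeasure : Measure ℝ :=
  (ENNReal.ofReal (2 * Real.pi))⁻¹ • (volume.restrict (Ico (-Real.pi) Real.pi))

/-- A Banach function lattice on `𝕋`. Functions on `𝕋` are `2π`-periodic functions `ℝ → ℂ`; they are
finite-valued and *not* identified when they agree almost everywhere, so that point values make
sense. "Measurable" means Lebesgue measurable. Only the values `nrm f` for `f ∈ carrier` matter.
For periodic functions "almost everywhere" on `ℝ` and on a period mean the same. -/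
structure TorusBanachLattice where
  /-- the functions that belong to the space -/
  carrier : Submodule ℂ (ℝ → ℂ)
  /-- the norm -/
  nrm : (ℝ → ℂ) → ℝ
  periodic : ∀ f ∈ carrier, Function.Periodic f (2 * Real.pi)
  aemeasurable : ∀ f ∈ carrier, AEMeasurable f volume
  nrm_nonneg : ∀ f ∈ carrier, 0 ≤ nrm f
  nrm_add_le : ∀ f ∈ carrier, ∀ g ∈ carrier, nrm (f + g) ≤ nrm f + nrm g
  nrm_smul : ∀ (c : ℂ), ∀ f ∈ carrier, nrm (c • f) = ‖c‖ * nrm f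
  ae_eq_zero_of_nrm_eq_zero : ∀ f ∈ carrier, nrm f = 0 → ∀ᵐ x, f x = 0
  complete : ∀ u : ℕ → ℝ → ℂ, (∀ i, u i ∈ carrier) →
    (∀ ε > 0, ∃ N, ∀ i ≥ N, ∀ j ≥ N, nrm (u i - u j) < ε) →
    ∃ f ∈ carrier, Tendsto (fun i => nrm (u i - f)) atTop (𝓝 0)
  /-- the lattice property -/
  lattice : ∀ f g : ℝ → ℂ, Function.Periodic f (2 * Real.pi) → AEMeasurable f volume →
    g ∈ carrier → (∀ᵐ x, ‖f x‖ ≤ ‖g x‖) → f ∈ carrier ∧ nrm f ≤ nrm g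
  /-- the Fatou property -/
  fatou : ∀ (u : ℕ → ℝ → ℝ) (f : ℝ → ℝ), (∀ i, (fun x => (u i x : ℂ)) ∈ carrier) →
    (∃ M, ∀ i, nrm (fun x => (u i x : ℂ)) ≤ M) →
    Function.Periodic f (2 * Real.pi) →
    (∀ᵐ x, (∀ i, 0 ≤ u i x) ∧ Monotone (fun i => u i x) ∧
      Tendsto (fun i => u i x) atTop (𝓝 (f x))) →
    (fun x => (f x : ℂ)) ∈ carrier ∧
      Tendsto (fun i => nrm (fun x => (u i x : ℂ))) atTop (𝓝 (nrm (fun x => (f x : ℂ))))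
  /-- characteristic functions of measurable sets (here given by their `2π`-periodic lift `E`)
  belong to the space, and integration over such sets is bounded on the space -/
  indicator : ∀ E : Set ℝ, NullMeasurableSet E volume → (∀ x, x + 2 * Real.pi ∈ E ↔ x ∈ E) →
    E.indicator (fun _ => (1 : ℂ)) ∈ carrier ∧
      ∃ c > 0, ∀ f ∈ carrier, ∫⁻ x in E, ‖f x‖ₑ ∂torusMeasure ≤ ENNReal.ofReal (c * nrm f)

/-- The Steklov average `A_h f (x) = h⁻¹ ∫_{x-h/2}^{x+h/2} f`. -/
noncomputable def steklov (h : ℝ) (f : ℝ → ℂ) : ℝ → ℂ :=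
  fun x => (h : ℂ)⁻¹ * ∫ t in (x - h / 2)..(x + h / 2), f t

/-- The shifted Steklov average `Ȧ_h f (x) = A_h f (x + h/2)`. -/
noncomputable def steklovDot (h : ℝ) (f : ℝ → ℂ) : ℝ → ℂ :=
  fun x => steklov h f (x + h / 2)

/-- `(I - A_h)^r f`. -/
noncomputable def subSteklovPow (h : ℝ) (r : ℕ) (f : ℝ → ℂ) : ℝ → ℂ :=
  (fun g => g - steklov h g)^[r] f

/-- `(I - Ȧ_h)^s f`. -/
noncomputable def subSteklovDotPow (h : ℝ) (s : ℕ) (f : ℝ → ℂ) : ℝ → ℂ :=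
  (fun g => g - steklovDot h g)^[s] f

/-- The Steklov averages act in the space and are uniformly bounded there. -/
def TorusBanachLattice.SteklovBounded (X : TorusBanachLattice) : Prop :=
  (∀ h > 0, ∀ f ∈ X.carrier, steklov h f ∈ X.carrier) ∧
    ∃ K : ℝ, ∀ h > 0, ∀ f ∈ X.carrier, X.nrm f ≤ 1 → X.nrm (steklov h f) ≤ K

/-- The trigonometric polynomials of degree at most `n`. -/
def trigPoly (n : ℕ) : Set (ℝ → ℂ) :=
  {T | ∃ c : ℤ → ℂ, ∀ x : ℝ,
    T x = ∑ k ∈ Finset.Icc (-(n : ℤ)) (n : ℤ), c k * Complex.exp (Complex.I * k * x)}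

/-- The sampling operator `∑_{k < m} f (x k) φ_k` with nodes `x 0, …, x (m - 1)`. -/
noncomputable def samplingOp (m : ℕ) (x : ℕ → ℝ) (φ : ℕ → ℝ → ℂ) (f : ℝ → ℂ) : ℝ → ℂ :=
  fun t => ∑ k ∈ Finset.range m, f (x k) * φ k t

/-- The step function `∑_{k < m} |f (x k)| χ_{[x k, x (k+1))}` on `𝕋`, as a `2π`-periodic function. -/
noncomputable def sampleStep (m : ℕ) (x : ℕ → ℝ) (f : ℝ → ℂ) : ℝ → ℂ :=
  fun t => ∑ k ∈ Finset.range m,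
    (⋃ j : ℤ, Ico (x k + j * (2 * Real.pi)) (x (k + 1) + j * (2 * Real.pi))).indicator
      (fun _ => ((‖f (x k)‖ : ℝ) : ℂ)) t

/-- The semi-norm `‖f‖_{X_n}` for the nodes `x 0, …, x (m - 1)`, with `x m = x 0 + 2π`. -/
noncomputable def TorusBanachLattice.sampleNrm (X : TorusBanachLattice) (m : ℕ) (x : ℕ → ℝ)
    (f : ℝ → ℂ) : ℝ :=
  X.nrm (sampleStep m x f)

/-! Write `h = γ/n`, `A` and `Ȧ` for the two averages with step `h`, and `G = G_n`.

The only tool for estimating norms in `X` is domination: a function bounded pointwise by a positive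
combination of centred averages of `|f|` has norm at most a constant times `‖f‖_X`. Translations
need not be bounded on `X`, so shifted averages are enlarged to centred ones. A Fourier multiplier
`F(k/n)` with `F` a compactly supported `C³` function has a kernel with cubic decay at scale `1/n`,
hence is dominated by dyadic averages with geometric weights and is bounded on `X` uniformly in `n`.
Bernstein's inequality and a Jackson estimate follow.

The heart is the realization `exists_realization`: some `T ∈ 𝒯_n` satisfies `‖f - T‖ + n⁻ˢ‖T⁽ˢ⁾‖ ≤ C
‖(I - Ȧ)ˢ f‖`. Here `T` is a smooth Fourier cutoff of `f`. For frequencies of order at most `n`, the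
symbol of `I - Ȧ` is `-ikh` times a nowhere vanishing smooth function, so it can be divided out by a
multiplier. For high frequencies, Jackson makes `Ȧ²` a contraction, so `I - Ȧ` is bounded below
(`exists_highFrequency_bound`).

Lower estimate: split `f = (f - Gf) + Gf`. On `f - Gf` the differences are bounded operators, apart
from the samples of `f - Gf` itself. On the polynomial `Gf` they are controlled by `n⁻ˢ‖(Gf)⁽ˢ⁾‖`,
which by (A4) and (A1) is at most a constant times `‖Gf - G(Gf)‖ = ‖G(f - Gf)‖`, hence times `‖f -
Gf‖_{X_n}`.

Upper estimate: with `T` from the realization, `f - Gf = (f - T) + (T - GT) - G(f - T)`. (A3)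
handles `T - GT`, and (A1) reduces the last term to `‖f - T‖_{X_n}`. This is not controlled by `‖f -
T‖_X`, but `(I - A)ʳ g - g` consists of averages, whose samples are controlled by `‖g‖_X`; so the
samples of `f - T` are recovered from those of `(I - A)ʳ f` and `(I - A)ʳ T`. -/

/-! ### Steklov averages and pointwise domination by averages of the modulus. -/

/-- `2π`-periodic functions that are integrable on bounded intervals. -/
def PeriodicIntegrable (f : ℝ → ℂ) : Prop :=
  Function.Periodic f (2 * Real.pi) ∧ ∀ a b : ℝ, IntervalIntegrable f volume a b

/-- The average of `‖f‖` over the interval of length `a` centred at `x`. -/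
noncomputable def absAvg (a : ℝ) (f : ℝ → ℂ) (x : ℝ) : ℝ :=
  a⁻¹ * ∫ t in (x - a / 2)..(x + a / 2), ‖f t‖

namespace PeriodicIntegrable

variable {f g : ℝ → ℂ}

theorem of_continuous (hf : Continuous f) (hp : Function.Periodic f (2 * Real.pi)) :
    PeriodicIntegrable f :=
  ⟨hp, fun a b => hf.intervalIntegrable a b⟩

theorem sub (hf : PeriodicIntegrable f) (hg : PeriodicIntegrable g) :
    PeriodicIntegrable (f - g) :=
  ⟨hf.1.sub hg.1, fun a b => (hf.2 a b).sub (hg.2 a b)⟩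

theorem const (c : ℂ) : PeriodicIntegrable (fun _ => c) :=
  of_continuous continuous_const (fun _ => rfl)

theorem norm (hf : PeriodicIntegrable f) : PeriodicIntegrable (fun t => (‖f t‖ : ℂ)) :=
  ⟨fun x => by simp [hf.1 x], fun a b =>
    ⟨(hf.2 a b).norm.1.ofReal, (hf.2 a b).norm.2.ofReal⟩⟩

theorem steklov_eq (hf : PeriodicIntegrable f) (h x : ℝ) :
    steklov h f x = (h : ℂ)⁻¹ * ((∫ t in (0 : ℝ)..(x + h / 2), f t) - ∫ t in (0 : ℝ)..(x - h / 2), f t) := by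
  rw [steklov, intervalIntegral.integral_interval_sub_left (hf.2 _ _) (hf.2 _ _)]

theorem continuous_steklov (hf : PeriodicIntegrable f) (h : ℝ) : Continuous (steklov h f) := by
  have hc := intervalIntegral.continuous_primitive hf.2 0
  rw [funext (hf.steklov_eq h)]
  exact continuous_const.mul ((hc.comp (by fun_prop)).sub (hc.comp (by fun_prop)))

theorem steklov (hf : PeriodicIntegrable f) (h : ℝ) : PeriodicIntegrable (steklov h f) := by
  refine of_continuous (hf.continuous_steklov h) fun x => ?_
  unfold _root_.steklov
  congr 1
  have := intervalIntegral.integral_comp_add_right (a := x - h / 2) (b := x + h / 2) f (2 * Real.pi)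
  rw [show x + 2 * Real.pi - h / 2 = x - h / 2 + 2 * Real.pi by ring,
    show x + 2 * Real.pi + h / 2 = x + h / 2 + 2 * Real.pi by ring, ← this]
  simp only [hf.1 _]

theorem steklovDot (hf : PeriodicIntegrable f) (h : ℝ) : PeriodicIntegrable (steklovDot h f) := by
  refine of_continuous ((hf.continuous_steklov h).comp (by fun_prop)) fun x => ?_
  unfold _root_.steklovDot
  rw [← (hf.steklov h).1 (x + h / 2)]
  congr 1
  ring

theorem continuous_steklovDot (hf : PeriodicIntegrable f) (h : ℝ) :
    Continuous (_root_.steklovDot h f) :=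
  (hf.continuous_steklov h).comp (by fun_prop)

theorem subSteklovPow (hf : PeriodicIntegrable f) (h : ℝ) (r : ℕ) :
    PeriodicIntegrable (subSteklovPow h r f) := by
  induction r with
  | zero => exact hf
  | succ r ih =>
    rw [_root_.subSteklovPow, Function.iterate_succ_apply']
    exact ih.sub (ih.steklov h)

theorem subSteklovDotPow (hf : PeriodicIntegrable f) (h : ℝ) (r : ℕ) :
    PeriodicIntegrable (subSteklovDotPow h r f) := by
  induction r with
  | zero => exact hf
  | succ r ih =>
    rw [_root_.subSteklovDotPow, Function.iterate_succ_apply']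
    exact ih.sub (ih.steklovDot h)

theorem integral_norm_le_absAvg (hf : PeriodicIntegrable f) {a b c y : ℝ} (ha : 0 < a) (hbc : b ≤ c)
    (hb : y - a / 2 ≤ b) (hc : c ≤ y + a / 2) : ∫ t in b..c, ‖f t‖ ≤ a * absAvg a f y := by
  rw [absAvg, mul_inv_cancel_left₀ ha.ne']
  exact intervalIntegral.integral_mono_interval hb hbc hc
    (Eventually.of_forall fun _ => norm_nonneg _) (hf.2 _ _).norm

end PeriodicIntegrable

theorem steklov_norm (a : ℝ) (f : ℝ → ℂ) (x : ℝ) :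
    steklov a (fun t => (‖f t‖ : ℂ)) x = (absAvg a f x : ℂ) := by
  simp [steklov, absAvg, intervalIntegral.integral_ofReal]

theorem absAvg_nonneg {a : ℝ} (ha : 0 < a) (f : ℝ → ℂ) (x : ℝ) : 0 ≤ absAvg a f x :=
  mul_nonneg (inv_nonneg.2 ha.le)
    (intervalIntegral.integral_nonneg (by linarith) fun _ _ => norm_nonneg _)

theorem steklovDot_eq (h : ℝ) (f : ℝ → ℂ) (x : ℝ) :
    steklovDot h f x = (h : ℂ)⁻¹ * ∫ t in x..(x + h), f t := by
  rw [steklovDot, steklov, show x + h / 2 - h / 2 = x by ring,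
    show x + h / 2 + h / 2 = x + h by ring]

theorem steklov_sub {f g : ℝ → ℂ} (hf : PeriodicIntegrable f) (hg : PeriodicIntegrable g) (h : ℝ) :
    steklov h (f - g) = steklov h f - steklov h g := by
  funext x
  simp only [steklov, Pi.sub_apply]
  rw [intervalIntegral.integral_sub (hf.2 _ _) (hg.2 _ _), mul_sub]

theorem steklovDot_sub {f g : ℝ → ℂ} (hf : PeriodicIntegrable f) (hg : PeriodicIntegrable g)
    (h : ℝ) : steklovDot h (f - g) = steklovDot h f - steklovDot h g := by
  funext x
  simp [steklovDot, steklov_sub hf hg]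

theorem subSteklovPow_succ (h : ℝ) (r : ℕ) (f : ℝ → ℂ) :
    subSteklovPow h (r + 1) f = subSteklovPow h r f - steklov h (subSteklovPow h r f) :=
  Function.iterate_succ_apply' _ _ _

theorem subSteklovDotPow_succ (h : ℝ) (r : ℕ) (f : ℝ → ℂ) :
    subSteklovDotPow h (r + 1) f =
      subSteklovDotPow h r f - steklovDot h (subSteklovDotPow h r f) :=
  Function.iterate_succ_apply' _ _ _

theorem subSteklovPow_sub {f g : ℝ → ℂ} (hf : PeriodicIntegrable f) (hg : PeriodicIntegrable g)
    (h : ℝ) (r : ℕ) :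
    subSteklovPow h r (f - g) = subSteklovPow h r f - subSteklovPow h r g := by
  induction r with
  | zero => rfl
  | succ r ih =>
    simp only [subSteklovPow_succ, ih, steklov_sub (hf.subSteklovPow h r) (hg.subSteklovPow h r)]
    abel

theorem subSteklovDotPow_sub {f g : ℝ → ℂ} (hf : PeriodicIntegrable f)
    (hg : PeriodicIntegrable g) (h : ℝ) (r : ℕ) :
    subSteklovDotPow h r (f - g) = subSteklovDotPow h r f - subSteklovDotPow h r g := by
  induction r with
  | zero => rfl
  | succ r ih =>
    simp only [subSteklovDotPow_succ, ih,
      steklovDot_sub (hf.subSteklovDotPow h r) (hg.subSteklovDotPow h r)]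
    abel

theorem norm_steklovDot_le {f : ℝ → ℂ} (hf : PeriodicIntegrable f) {h : ℝ} (hh : 0 < h) (x : ℝ) :
    ‖steklovDot h f x‖ ≤ 2 * absAvg (2 * h) f x := by
  rw [steklovDot_eq, norm_mul, norm_inv, Complex.norm_real, Real.norm_of_nonneg hh.le,
    inv_mul_le_iff₀ hh]
  refine (intervalIntegral.norm_integral_le_integral_norm (by linarith)).trans ?_
  refine (hf.integral_norm_le_absAvg (a := 2 * h) (y := x) (by linarith) (by linarith)
    (by linarith) (by linarith)).trans_eq (by ring)

/-- The window `[x + h, x + 2h]` lies in the centred window of length `4h`. This replaces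
boundedness of translations, which is not assumed on `X`. -/
theorem norm_steklovDot_shift_le {f : ℝ → ℂ} (hf : PeriodicIntegrable f) {h : ℝ} (hh : 0 < h)
    (x : ℝ) : ‖steklovDot h f (x + h)‖ ≤ 4 * absAvg (4 * h) f x := by
  rw [steklovDot_eq, norm_mul, norm_inv, Complex.norm_real, Real.norm_of_nonneg hh.le,
    inv_mul_le_iff₀ hh]
  refine (intervalIntegral.norm_integral_le_integral_norm (by linarith)).trans ?_
  refine (hf.integral_norm_le_absAvg (a := 4 * h) (y := x) (by linarith) (by linarith)
    (by linarith) (by linarith)).trans_eq (by ring)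

theorem norm_steklov_le_absAvg {f : ℝ → ℂ} (hf : PeriodicIntegrable f) {h a x y : ℝ} (hh : 0 < h)
    (h1 : y - a / 2 ≤ x - h / 2) (h2 : x + h / 2 ≤ y + a / 2) :
    ‖steklov h f x‖ ≤ a / h * absAvg a f y := by
  rw [steklov, norm_mul, norm_inv, Complex.norm_real, Real.norm_of_nonneg hh.le,
    inv_mul_le_iff₀ hh]
  refine (intervalIntegral.norm_integral_le_integral_norm (by linarith)).trans ?_
  refine (hf.integral_norm_le_absAvg (a := a) (y := y) (by linarith) (by linarith)
    h1 h2).trans_eq (by field_simp)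

/-- Increments of a `C¹` function are controlled by averages of the derivative. -/
theorem norm_sub_le_absAvg {G G' : ℝ → ℂ} (hG : ∀ y, HasDerivAt G (G' y) y)
    (hG' : PeriodicIntegrable G') {a x y z : ℝ} (ha : 0 < a)
    (hy : |y - x| ≤ a / 2) (hz : |z - x| ≤ a / 2) : ‖G y - G z‖ ≤ a * absAvg a G' x := by
  wlog hzy : z ≤ y generalizing y z
  · rw [norm_sub_rev]
    exact this hz hy (le_of_not_ge hzy)
  have hy := abs_le.1 hy
  have hz := abs_le.1 hz
  rw [← intervalIntegral.integral_eq_sub_of_hasDerivAt (fun t _ => hG t) (hG'.2 _ _)]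
  refine (intervalIntegral.norm_integral_le_integral_norm hzy).trans ?_
  exact hG'.integral_norm_le_absAvg ha hzy (by linarith) (by linarith)

theorem norm_sub_steklovDot_le {G G' : ℝ → ℂ} (hG : ∀ y, HasDerivAt G (G' y) y)
    (hG' : PeriodicIntegrable G') {h : ℝ} (hh : 0 < h) (x : ℝ) :
    ‖G x - steklovDot h G x‖ ≤ 2 * h * absAvg (2 * h) G' x := by
  have hc : Continuous G := continuous_iff_continuousAt.2 fun y => (hG y).continuousAt
  have e1 : G x - steklovDot h G x = (h : ℂ)⁻¹ * ∫ t in x..(x + h), (G x - G t) := by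
    rw [intervalIntegral.integral_sub (by simp) (hc.intervalIntegrable _ _), steklovDot_eq]
    have : (h : ℂ) ≠ 0 := by exact_mod_cast hh.ne'
    simp
    field_simp
  rw [e1, norm_mul, norm_inv, Complex.norm_real, Real.norm_of_nonneg hh.le, inv_mul_le_iff₀ hh]
  refine (intervalIntegral.norm_integral_le_of_norm_le_const
    (C := 2 * h * absAvg (2 * h) G' x) fun t ht => ?_).trans_eq ?_
  · rw [uIoc_of_le (by linarith)] at ht
    refine norm_sub_le_absAvg hG hG' (by linarith) ?_ ?_
    · simp [hh.le]
    · rw [abs_le]; constructor <;> linarith [ht.1, ht.2]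
  · rw [add_sub_cancel_left, abs_of_pos hh]; ring

/-- The window is symmetric, so the linear Taylor term at `x` averages to zero and may be subtracted
first. This gains a second order in `h`, and is why a power `r` of `I - A_h` corresponds to `2r`
derivatives. -/
theorem norm_sub_steklov_le {G G' G'' : ℝ → ℂ} (hG : ∀ y, HasDerivAt G (G' y) y)
    (hG' : ∀ y, HasDerivAt G' (G'' y) y)
    (hG'' : PeriodicIntegrable G'') {h : ℝ} (hh : 0 < h) (x : ℝ) :
    ‖G x - steklov h G x‖ ≤ h ^ 2 * absAvg h G'' x := by
  have hc : Continuous G := continuous_iff_continuousAt.2 fun y => (hG y).continuousAt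
  have hd : ∀ y, HasDerivAt (fun t : ℝ => G t - G' x * ((t : ℂ) - x)) (G' y - G' x) y := fun y => by
    have h1 := (((hasDerivAt_id y).ofReal_comp.sub_const (x : ℂ)).const_mul (G' x))
    rw [show G' y - G' x = G' y - G' x * ((1 : ℝ) : ℂ) by simp]
    exact (hG y).sub h1
  have hlin : ∫ t in (x - h / 2)..(x + h / 2), ((t : ℂ) - x) = 0 := by
    have : ∀ t ∈ uIcc (x - h / 2) (x + h / 2),
        HasDerivAt (fun t : ℝ => ((t : ℂ) - x) ^ 2 / 2) ((t : ℂ) - x) t := fun t _ => by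
      have h1 := ((hasDerivAt_id t).ofReal_comp.sub_const (x : ℂ)).pow 2
      have h2 := h1.div_const 2
      refine HasDerivAt.congr_deriv h2 ?_
      simp
    rw [intervalIntegral.integral_eq_sub_of_hasDerivAt this
      (Continuous.intervalIntegrable (by fun_prop) _ _)]
    push_cast
    ring
  have e1 : G x - steklov h G x = (h : ℂ)⁻¹ * ∫ t in (x - h / 2)..(x + h / 2),
      ((G x - G' x * ((x : ℂ) - x)) - (G t - G' x * ((t : ℂ) - x))) := by
    have hi : IntervalIntegrable (fun t : ℝ => G' x * ((t : ℂ) - x)) volume (x - h / 2)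
      (x + h / 2) := Continuous.intervalIntegrable (by fun_prop) _ _
    rw [intervalIntegral.integral_sub (by simp) ((hc.intervalIntegrable _ _).sub hi),
      intervalIntegral.integral_sub (hc.intervalIntegrable _ _) hi, steklov,
      intervalIntegral.integral_const_mul, hlin]
    have : (h : ℂ) ≠ 0 := by exact_mod_cast hh.ne'
    simp
    field_simp
  rw [e1, norm_mul, norm_inv, Complex.norm_real, Real.norm_of_nonneg hh.le, inv_mul_le_iff₀ hh]
  refine (intervalIntegral.norm_integral_le_of_norm_le_const
    (C := h ^ 2 * absAvg h G'' x) fun t ht => ?_).trans_eq ?_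
  · rw [uIoc_of_le (by linarith)] at ht
    have hconv : Convex ℝ (Icc (x - h / 2) (x + h / 2)) := convex_Icc _ _
    have := hconv.norm_image_sub_le_of_norm_hasDerivWithin_le (C := h * absAvg h G'' x)
      (fun y _ => (hd y).hasDerivWithinAt) (fun y hy => ?_) (x := t) (y := x)
      ⟨ht.1.le, ht.2⟩ ⟨by linarith, by linarith⟩
    · refine this.trans ?_
      have h0 := absAvg_nonneg hh G'' x
      have : ‖x - t‖ ≤ h := by
        rw [Real.norm_eq_abs, abs_le]; constructor <;> linarith [ht.1, ht.2]
      calc _ ≤ h * absAvg h G'' x * h := by gcongr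
        _ = _ := by ring
    · refine norm_sub_le_absAvg hG' hG'' hh ?_ ?_
      · rw [abs_le]; constructor <;> linarith [hy.1, hy.2]
      · simp; positivity
  · rw [show x + h / 2 - (x - h / 2) = h by ring, abs_of_pos hh]; ring

/-! ### Steklov operators in the norm of the lattice. -/

namespace TorusBanachLattice

variable {X : TorusBanachLattice} {f g : ℝ → ℂ}

/-- The integration axiom for the full circle gives integrability over one period; periodicity does
the rest. -/
theorem periodicIntegrable (hf : f ∈ X.carrier) : PeriodicIntegrable f := by
  obtain ⟨-, c, -, hc⟩ := X.indicator univ .univ (by simp)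
  have h1 := (hc f hf).trans_lt ENNReal.ofReal_lt_top
  rw [Measure.restrict_univ, torusMeasure, lintegral_smul_measure, smul_eq_mul] at h1
  have h2 : ∫⁻ x in Ico (-Real.pi) Real.pi, ‖f x‖ₑ < ⊤ := by
    by_contra h
    rw [not_lt, top_le_iff] at h
    rw [h, ENNReal.mul_top (ENNReal.inv_ne_zero.2 ENNReal.ofReal_ne_top)] at h1
    exact lt_irrefl _ h1
  have h3 : IntegrableOn f (Ico (-Real.pi) Real.pi) volume :=
    ⟨(X.aemeasurable f hf).aestronglyMeasurable.restrict, h2⟩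
  have h4 : IntervalIntegrable f volume (-Real.pi) (-Real.pi + 2 * Real.pi) := by
    rw [intervalIntegrable_iff_integrableOn_Ico_of_le (by linarith [Real.pi_pos])]
    rwa [show -Real.pi + 2 * Real.pi = Real.pi by ring]
  exact ⟨X.periodic f hf, fun a b =>
    (X.periodic f hf).intervalIntegrable Real.two_pi_pos.ne' h4 a b⟩

theorem nrm_zero (X : TorusBanachLattice) : X.nrm 0 = 0 := by
  have := X.nrm_smul 0 0 X.carrier.zero_mem
  simpa using this

theorem nrm_sub_le (hf : f ∈ X.carrier) (hg : g ∈ X.carrier) :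
    X.nrm (f - g) ≤ X.nrm f + X.nrm g := by
  have h := X.nrm_smul (-1) g hg
  have h2 := X.nrm_add_le f hf ((-1 : ℂ) • g) (X.carrier.smul_mem _ hg)
  rw [h] at h2
  simpa [sub_eq_add_neg] using h2

theorem const_mem (X : TorusBanachLattice) (c : ℂ) : (fun _ : ℝ => c) ∈ X.carrier := by
  have h := X.carrier.smul_mem c (X.indicator univ .univ (by simp)).1
  convert h using 1
  ext
  simp

theorem mem_of_bounded (hp : Function.Periodic f (2 * Real.pi)) (hm : AEMeasurable f volume) (C : ℝ)
    (hC : ∀ x, ‖f x‖ ≤ C) : f ∈ X.carrier :=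
  (X.lattice f _ hp hm (X.const_mem (C : ℂ)) (Eventually.of_forall fun x => by
    simpa using (hC x).trans (le_abs_self C))).1

theorem mem_of_continuous (hp : Function.Periodic f (2 * Real.pi)) (hf : Continuous f) :
    f ∈ X.carrier := by
  obtain ⟨C, hC⟩ := (isCompact_Icc (a := (0 : ℝ)) (b := 2 * Real.pi)).exists_bound_of_continuousOn
    hf.continuousOn
  refine mem_of_bounded hp hf.measurable.aemeasurable C fun x => ?_
  obtain ⟨y, hy, hxy⟩ := hp.exists_mem_Ico₀ Real.two_pi_pos x
  rw [hxy]
  exact hC y ⟨hy.1, hy.2.le⟩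

theorem nrm_norm (hf : f ∈ X.carrier) :
    (fun t => (‖f t‖ : ℂ)) ∈ X.carrier ∧ X.nrm (fun t => (‖f t‖ : ℂ)) ≤ X.nrm f :=
  X.lattice _ f (periodicIntegrable hf).norm.1
    (Complex.measurable_ofReal.comp_aemeasurable (X.aemeasurable f hf).norm)
    hf (Eventually.of_forall fun x => by simp)

/-- The Steklov averages are bounded on `X` with norm at most `K`. -/
def SteklovBoundedBy (X : TorusBanachLattice) (K : ℝ) : Prop :=
  0 ≤ K ∧ ∀ h > 0, ∀ f ∈ X.carrier, steklov h f ∈ X.carrier ∧ X.nrm (steklov h f) ≤ K * X.nrm f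

theorem SteklovBounded.exists_bound (hX : X.SteklovBounded) : ∃ K, X.SteklovBoundedBy K := by
  obtain ⟨h1, K, hK⟩ := hX
  have hsmul : ∀ (h : ℝ) (c : ℂ) (f : ℝ → ℂ), steklov h (c • f) = c • steklov h f := fun h c f => by
    funext x
    simp only [steklov, Pi.smul_apply, smul_eq_mul, intervalIntegral.integral_const_mul]
    ring
  have key : ∀ h > 0, ∀ f ∈ X.carrier, ∀ c : ℝ, 0 ≤ c → c * X.nrm f ≤ 1 →
      c * X.nrm (steklov h f) ≤ K := by
    intro h hh f hf c hc hcf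
    have := hK h hh ((c : ℂ) • f) (X.carrier.smul_mem _ hf)
      (by rwa [X.nrm_smul _ _ hf, Complex.norm_real, Real.norm_of_nonneg hc])
    rwa [hsmul, X.nrm_smul _ _ (h1 h hh f hf), Complex.norm_real, Real.norm_of_nonneg hc] at this
  have hK0 : 0 ≤ K := by
    have := key 1 one_pos 0 X.carrier.zero_mem 0 le_rfl (by simp)
    simpa using this
  refine ⟨K, hK0, fun h hh f hf => ⟨h1 h hh f hf, ?_⟩⟩
  rcases (X.nrm_nonneg f hf).eq_or_lt with h0 | h0
  · rw [← h0, mul_zero]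
    -- If `‖f‖ = 0`, every multiple of `f` lies in the unit ball; scaling by `(K + 1)/‖A_h f‖` would
    -- break the bound `K`.
    by_contra! hlt
    have := key h hh f hf ((K + 1) / X.nrm (steklov h f)) (by positivity) (by simp [← h0])
    rw [div_mul_cancel₀ _ hlt.ne'] at this
    linarith
  · have := key h hh f hf (X.nrm f)⁻¹ (by positivity) (inv_mul_cancel₀ h0.ne').le
    rwa [inv_mul_le_iff₀ h0, mul_comm] at this

variable {K : ℝ}

theorem SteklovBoundedBy.nrm_absAvg_le (hK : X.SteklovBoundedBy K) (hf : f ∈ X.carrier) {a : ℝ}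
    (ha : 0 < a) : (fun x => (absAvg a f x : ℂ)) ∈ X.carrier ∧
      X.nrm (fun x => (absAvg a f x : ℂ)) ≤ K * X.nrm f := by
  have h := hK.2 a ha _ (nrm_norm hf).1
  rw [funext (steklov_norm a f)] at h
  exact ⟨h.1, h.2.trans (mul_le_mul_of_nonneg_left (nrm_norm hf).2 hK.1)⟩

theorem SteklovBoundedBy.nrm_sum_absAvg_le (hK : X.SteklovBoundedBy K) (hf : f ∈ X.carrier)
    (w a : ℕ → ℝ) (hw : ∀ j, 0 ≤ w j) (ha : ∀ j, 0 < a j) (J : ℕ) :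
    (fun x => ((∑ j ∈ Finset.range J, w j * absAvg (a j) f x : ℝ) : ℂ)) ∈ X.carrier ∧
      X.nrm (fun x => ((∑ j ∈ Finset.range J, w j * absAvg (a j) f x : ℝ) : ℂ)) ≤
        (∑ j ∈ Finset.range J, w j) * (K * X.nrm f) := by
  induction J with
  | zero => simpa using ⟨X.carrier.zero_mem, X.nrm_zero.le⟩
  | succ J ih =>
    have h := hK.nrm_absAvg_le hf (ha J)
    have e : (fun x => ((∑ j ∈ Finset.range (J + 1), w j * absAvg (a j) f x : ℝ) : ℂ)) =
        (fun x => ((∑ j ∈ Finset.range J, w j * absAvg (a j) f x : ℝ) : ℂ)) +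
          (w J : ℂ) • (fun x => (absAvg (a J) f x : ℂ)) := by
      funext x
      simp [Finset.sum_range_succ]
    rw [e, Finset.sum_range_succ, add_mul]
    refine ⟨X.carrier.add_mem ih.1 (X.carrier.smul_mem _ h.1),
      (X.nrm_add_le _ ih.1 _ (X.carrier.smul_mem _ h.1)).trans (add_le_add ih.2 ?_)⟩
    rw [X.nrm_smul _ _ h.1, Complex.norm_real, Real.norm_of_nonneg (hw J)]
    exact mul_le_mul_of_nonneg_left h.2 (hw J)

/-- The transfer principle from pointwise to norm estimates. The number of averages `J` does not
enter the bound, only the total weight, so `J` may grow with `n`. -/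
theorem SteklovBoundedBy.nrm_le_of_le_sum (hK : X.SteklovBoundedBy K) (hf : f ∈ X.carrier)
    (w a : ℕ → ℝ) (hw : ∀ j, 0 ≤ w j) (ha : ∀ j, 0 < a j) (J : ℕ)
    (hp : Function.Periodic g (2 * Real.pi)) (hm : AEMeasurable g volume)
    (hg : ∀ x, ‖g x‖ ≤ ∑ j ∈ Finset.range J, w j * absAvg (a j) f x) :
    g ∈ X.carrier ∧ X.nrm g ≤ (∑ j ∈ Finset.range J, w j) * (K * X.nrm f) := by
  have h := hK.nrm_sum_absAvg_le hf w a hw ha J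
  have h2 := X.lattice g _ hp hm h.1 (Eventually.of_forall fun x => by
    rw [Complex.norm_real]
    exact (hg x).trans (le_abs_self _))
  exact ⟨h2.1, h2.2.trans h.2⟩

theorem SteklovBoundedBy.nrm_le_of_le_absAvg (hK : X.SteklovBoundedBy K) (hf : f ∈ X.carrier)
    {w a : ℝ} (hw : 0 ≤ w) (ha : 0 < a) (hp : Function.Periodic g (2 * Real.pi))
    (hm : AEMeasurable g volume) (hg : ∀ x, ‖g x‖ ≤ w * absAvg a f x) :
    g ∈ X.carrier ∧ X.nrm g ≤ w * (K * X.nrm f) := by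
  have := hK.nrm_le_of_le_sum hf (fun _ => w) (fun _ => a) (fun _ => hw) (fun _ => ha) 1 hp hm
    (by simpa using hg)
  simpa using this

theorem SteklovBoundedBy.nrm_steklovDot_le (hK : X.SteklovBoundedBy K) (hf : f ∈ X.carrier) {h : ℝ}
    (hh : 0 < h) : steklovDot h f ∈ X.carrier ∧ X.nrm (steklovDot h f) ≤ 2 * (K * X.nrm f) :=
  have hf' := periodicIntegrable hf
  hK.nrm_le_of_le_absAvg hf zero_le_two (by positivity) (hf'.steklovDot h).1
    (hf'.continuous_steklovDot h).measurable.aemeasurable (norm_steklovDot_le hf' hh)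

theorem SteklovBoundedBy.nrm_subSteklovPow_le (hK : X.SteklovBoundedBy K) (hf : f ∈ X.carrier) {h : ℝ}
    (hh : 0 < h) (r : ℕ) : subSteklovPow h r f ∈ X.carrier ∧
      X.nrm (subSteklovPow h r f) ≤ (1 + K) ^ r * X.nrm f := by
  induction r with
  | zero => simpa [subSteklovPow] using hf
  | succ r ih =>
    have h1 := hK.2 h hh _ ih.1
    have h0 := hK.1
    rw [subSteklovPow_succ]
    refine ⟨X.carrier.sub_mem ih.1 h1.1, (nrm_sub_le ih.1 h1.1).trans ?_⟩
    calc _ ≤ (1 + K) * X.nrm (subSteklovPow h r f) := by linarith [h1.2]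
      _ ≤ (1 + K) * ((1 + K) ^ r * X.nrm f) := by gcongr; exact ih.2
      _ = _ := by ring

theorem SteklovBoundedBy.nrm_subSteklovDotPow_le (hK : X.SteklovBoundedBy K) (hf : f ∈ X.carrier)
    {h : ℝ} (hh : 0 < h) (r : ℕ) : subSteklovDotPow h r f ∈ X.carrier ∧
      X.nrm (subSteklovDotPow h r f) ≤ (1 + 2 * K) ^ r * X.nrm f := by
  induction r with
  | zero => simpa [subSteklovDotPow] using hf
  | succ r ih =>
    have h1 := hK.nrm_steklovDot_le ih.1 hh
    have h0 := hK.1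
    rw [subSteklovDotPow_succ]
    refine ⟨X.carrier.sub_mem ih.1 h1.1, (nrm_sub_le ih.1 h1.1).trans ?_⟩
    calc _ ≤ (1 + 2 * K) * X.nrm (subSteklovDotPow h r f) := by linarith [h1.2]
      _ ≤ (1 + 2 * K) * ((1 + 2 * K) ^ r * X.nrm f) := by gcongr; exact ih.2
      _ = _ := by ring

end TorusBanachLattice

/-! ### Trigonometric sums, Fourier coefficients and the symbols of the averages. -/

/-- The trigonometric sum `∑_{|k| ≤ M} c_k e^{ikx}`. -/
noncomputable def trigSum (M : ℕ) (c : ℤ → ℂ) (x : ℝ) : ℂ :=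
  ∑ k ∈ Finset.Icc (-(M : ℤ)) M, c k * Complex.exp (Complex.I * k * x)

/-- The Fourier coefficients of a `2π`-periodic function. -/
noncomputable def coef (f : ℝ → ℂ) (k : ℤ) : ℂ :=
  (2 * Real.pi : ℂ)⁻¹ * ∫ t in (-Real.pi)..Real.pi, f t * Complex.exp (-(Complex.I * k * t))

/-- The Fourier multiplier operator with symbol `c`, truncated to frequencies `|k| ≤ M`. -/
noncomputable def fourierMult (M : ℕ) (c : ℤ → ℂ) (f : ℝ → ℂ) : ℝ → ℂ :=
  trigSum M fun k => c k * coef f k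

theorem mem_trigPoly_iff {n : ℕ} {T : ℝ → ℂ} : T ∈ trigPoly n ↔ ∃ c, T = trigSum n c :=
  ⟨fun ⟨c, hc⟩ => ⟨c, funext hc⟩, fun ⟨c, hc⟩ => ⟨c, fun x => by rw [hc]; rfl⟩⟩

theorem trigSum_congr {M : ℕ} {c d : ℤ → ℂ} (h : ∀ k, |k| ≤ (M : ℤ) → c k = d k) :
    trigSum M c = trigSum M d := by
  funext x
  refine Finset.sum_congr rfl fun k hk => ?_
  rw [h k (abs_le.2 (Finset.mem_Icc.1 hk))]

theorem trigSum_sub (M : ℕ) (c d : ℤ → ℂ) :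
    trigSum M c - trigSum M d = trigSum M (fun k => c k - d k) := by
  funext x
  simp [trigSum, sub_mul]

theorem smul_trigSum (M : ℕ) (c : ℤ → ℂ) (a : ℂ) :
    a • trigSum M c = trigSum M (fun k => a * c k) := by
  funext x
  simp [trigSum, Finset.mul_sum, mul_assoc]

theorem trigSum_extend {M N : ℕ} (hNM : N ≤ M) {c : ℤ → ℂ} (hc : ∀ k, (N : ℤ) < |k| → c k = 0) :
    trigSum M c = trigSum N c := by
  funext x
  refine (Finset.sum_subset (fun k hk => ?_) fun k _ hk => ?_).symm
  · rw [Finset.mem_Icc] at *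
    omega
  · rw [hc k, zero_mul]
    by_contra! h
    exact hk (Finset.mem_Icc.2 (abs_le.1 h))

theorem periodic_exp_int (k : ℤ) :
    Function.Periodic (fun x : ℝ => Complex.exp (Complex.I * k * x)) (2 * Real.pi) := fun x => by
  simp only
  rw [show Complex.I * k * ((x + 2 * Real.pi : ℝ) : ℂ) =
    Complex.I * k * x + k * (2 * Real.pi * Complex.I) by push_cast; ring, Complex.exp_add,
    Complex.exp_int_mul_two_pi_mul_I, mul_one]

theorem periodic_trigSum (M : ℕ) (c : ℤ → ℂ) : Function.Periodic (trigSum M c) (2 * Real.pi) :=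
  fun x => Finset.sum_congr rfl fun k _ => congrArg (c k * ·) (periodic_exp_int k x)

@[fun_prop]
theorem continuous_trigSum (M : ℕ) (c : ℤ → ℂ) : Continuous (trigSum M c) := by
  unfold trigSum
  fun_prop

theorem periodicIntegrable_trigSum (M : ℕ) (c : ℤ → ℂ) : PeriodicIntegrable (trigSum M c) :=
  .of_continuous (continuous_trigSum M c) (periodic_trigSum M c)

theorem trigSum_mem (X : TorusBanachLattice) (M : ℕ) (c : ℤ → ℂ) : trigSum M c ∈ X.carrier :=
  X.mem_of_continuous (periodic_trigSum M c) (continuous_trigSum M c)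

theorem hasDerivAt_trigSum (M : ℕ) (c : ℤ → ℂ) (x : ℝ) :
    HasDerivAt (trigSum M c) (trigSum M (fun k => Complex.I * k * c k) x) x := by
  unfold trigSum
  refine HasDerivAt.fun_sum fun k _ => ?_
  have h1 : HasDerivAt (fun y : ℝ => Complex.I * k * (y : ℂ)) (Complex.I * k) x := by
    simpa using (hasDerivAt_id x).ofReal_comp.const_mul (Complex.I * k)
  exact (h1.cexp.const_mul (c k)).congr_deriv (by ring)

theorem iteratedDeriv_trigSum (M : ℕ) (c : ℤ → ℂ) (s : ℕ) :
    iteratedDeriv s (trigSum M c) = trigSum M (fun k => (Complex.I * k) ^ s * c k) := by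
  induction s with
  | zero => simp
  | succ s ih =>
    rw [iteratedDeriv_succ, ih]
    funext x
    rw [(hasDerivAt_trigSum M _ x).deriv]
    congr 1
    funext k
    ring

theorem integral_exp_int (k : ℤ) :
    ∫ t in (-Real.pi)..Real.pi, Complex.exp (Complex.I * k * t) =
      if k = 0 then (2 * Real.pi : ℂ) else 0 := by
  split_ifs with h
  · simp [h]; ring
  · rw [integral_exp_mul_complex (by simp [h])]
    have := periodic_exp_int k (-Real.pi)
    rw [show -Real.pi + 2 * Real.pi = Real.pi by ring] at this
    simp only at this
    rw [this, sub_self, zero_div]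

theorem coef_trigSum (M : ℕ) (c : ℤ → ℂ) (j : ℤ) :
    coef (trigSum M c) j = if |j| ≤ (M : ℤ) then c j else 0 := by
  have hpi : (2 * Real.pi : ℂ) ≠ 0 := by exact_mod_cast Real.two_pi_pos.ne'
  have h1 : ∀ t : ℝ, trigSum M c t * Complex.exp (-(Complex.I * j * t)) =
      ∑ k ∈ Finset.Icc (-(M : ℤ)) M, c k * Complex.exp (Complex.I * (k - j : ℤ) * t) := fun t => by
    rw [trigSum, Finset.sum_mul]
    refine Finset.sum_congr rfl fun k _ => ?_
    rw [mul_assoc, ← Complex.exp_add]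
    congr 2
    push_cast
    ring
  simp only [coef, h1]
  rw [intervalIntegral.integral_finsetSum
    fun k _ => Continuous.intervalIntegrable (by fun_prop) _ _]
  simp only [intervalIntegral.integral_const_mul, integral_exp_int, sub_eq_zero, mul_ite, mul_zero]
  rw [Finset.sum_ite_eq']
  simp only [Finset.mem_Icc, ← abs_le]
  split_ifs
  · field_simp
  · simp

theorem PeriodicIntegrable.mul_continuous {f g : ℝ → ℂ} (hf : PeriodicIntegrable f)
    (hg : Continuous g) (a b : ℝ) : IntervalIntegrable (fun t => f t * g t) volume a b :=
  (hf.2 a b).mul_continuousOn hg.continuousOn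

theorem coef_sub {f g : ℝ → ℂ} (hf : PeriodicIntegrable f) (hg : PeriodicIntegrable g) (k : ℤ) :
    coef (f - g) k = coef f k - coef g k := by
  simp only [coef, Pi.sub_apply, sub_mul]
  rw [intervalIntegral.integral_sub (hf.mul_continuous (by fun_prop) _ _)
    (hg.mul_continuous (by fun_prop) _ _), mul_sub]

/-- The symbol of the shifted Steklov average. -/
noncomputable def steklovSymbol (h : ℝ) (k : ℤ) : ℂ :=
  (h : ℂ)⁻¹ * ∫ t in (0 : ℝ)..h, Complex.exp (Complex.I * k * t)

theorem coef_steklovDot {f : ℝ → ℂ} (hf : PeriodicIntegrable f) {h : ℝ} (hh : 0 < h) (k : ℤ) :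
    coef (steklovDot h f) k = steklovSymbol h k * coef f k := by
  have hpi := Real.pi_pos
  set e : ℝ → ℂ := fun t => Complex.exp (-(Complex.I * k * t)) with he
  have hec : Continuous e := by fun_prop
  have h1 : ∀ x, steklovDot h f x * e x = (h : ℂ)⁻¹ * ∫ t in (-h)..0, f (x - t) * e x := fun x => by
    rw [steklovDot_eq, intervalIntegral.integral_mul_const,
      intervalIntegral.integral_comp_sub_left f x, mul_assoc]
    simp
  have hswap : ∫ x in (-Real.pi)..Real.pi, ∫ t in (-h)..0, f (x - t) * e x =
      ∫ t in (-h)..0, ∫ x in (-Real.pi)..Real.pi, f (x - t) * e x := by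
    rw [intervalIntegral.integral_of_le (by linarith : -Real.pi ≤ Real.pi),
      intervalIntegral.integral_of_le (by linarith : -h ≤ 0)]
    simp only [intervalIntegral.integral_of_le (by linarith : -Real.pi ≤ Real.pi),
      intervalIntegral.integral_of_le (by linarith : -h ≤ 0)]
    refine integral_integral_swap ?_
    -- For Fubini: on the rectangle, `x - t` stays in `(-π, π + h]`, so the integrand agrees with a
    -- unimodular factor times the convolution integrand of two integrable truncations.
    have i1 : Integrable ((Ioc (-h) 0).indicator fun _ => (1 : ℂ)) volume :=
      (integrable_indicator_iff measurableSet_Ioc).2 (by simp)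
    have i2 : Integrable ((Ioc (-Real.pi) (Real.pi + h)).indicator f) volume :=
      (integrable_indicator_iff measurableSet_Ioc).2 (hf.2 _ _).1
    have i3 := (i1.convolution_integrand (ContinuousLinearMap.mul ℝ ℂ) i2).integrableOn
      (s := Ioc (-Real.pi) Real.pi ×ˢ Ioc (-h) 0)
    rw [IntegrableOn, ← Measure.prod_restrict] at i3
    have i4 := i3.bdd_mul (c := 1) (f := fun p : ℝ × ℝ => e p.1)
      (hec.comp continuous_fst).aestronglyMeasurable (Eventually.of_forall fun p => by
        simp [he, Complex.norm_exp])
    refine i4.congr ?_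
    rw [Measure.prod_restrict]
    filter_upwards [ae_restrict_mem (measurableSet_Ioc.prod measurableSet_Ioc)] with p hp
    obtain ⟨⟨h1, h2⟩, h3, h4⟩ := hp
    have m1 : p.2 ∈ Ioc (-h) 0 := ⟨h3, h4⟩
    have m2 : p.1 - p.2 ∈ Ioc (-Real.pi) (Real.pi + h) := ⟨by linarith, by linarith⟩
    simp [Function.uncurry, m1, indicator_of_mem m2, mul_comm]
  have h2 : ∀ t, ∫ x in (-Real.pi)..Real.pi, f (x - t) * e x =
      Complex.exp (Complex.I * k * (-t : ℝ)) * ∫ x in (-Real.pi)..Real.pi, f x * e x := fun t => by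
    have hper : Function.Periodic (fun x => f x * e x) (2 * Real.pi) := fun x => by
      have := periodic_exp_int (-k) x
      simp only [he, hf.1 x]
      congr 1
      convert this using 2 <;> push_cast <;> ring
    have h3 := intervalIntegral.integral_comp_sub_right (a := -Real.pi) (b := Real.pi)
      (fun x => f x * e x) t
    have h4 := hper.intervalIntegral_add_eq (-Real.pi - t) (-Real.pi)
    rw [show -Real.pi - t + 2 * Real.pi = Real.pi - t by ring,
      show -Real.pi + 2 * Real.pi = Real.pi by ring] at h4
    rw [← h4, ← h3, ← intervalIntegral.integral_const_mul]
    congr 1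
    funext x
    simp only [he]
    rw [mul_left_comm, ← Complex.exp_add]
    congr 2
    push_cast
    ring
  have h5 : ∫ t in (-h)..0, Complex.exp (Complex.I * k * (-t : ℝ)) =
      ∫ t in (0 : ℝ)..h, Complex.exp (Complex.I * k * t) := by
    rw [intervalIntegral.integral_comp_neg (fun t : ℝ => Complex.exp (Complex.I * k * t))]
    simp
  simp only [coef]
  rw [show (∫ t in (-Real.pi)..Real.pi, steklovDot h f t * Complex.exp (-(Complex.I * k * t))) =
    ∫ t in (-Real.pi)..Real.pi, (h : ℂ)⁻¹ * ∫ u in (-h)..0, f (t - u) * e t from by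
      congr 1; funext x; exact h1 x]
  rw [intervalIntegral.integral_const_mul, hswap]
  simp only [h2]
  rw [intervalIntegral.integral_mul_const, h5, steklovSymbol]
  ring

theorem coef_subSteklovDotPow {f : ℝ → ℂ} (hf : PeriodicIntegrable f) {h : ℝ} (hh : 0 < h)
    (s : ℕ) (k : ℤ) :
    coef (subSteklovDotPow h s f) k = (1 - steklovSymbol h k) ^ s * coef f k := by
  induction s with
  | zero => simp [subSteklovDotPow]
  | succ s ih =>
    have := hf.subSteklovDotPow h s
    rw [subSteklovDotPow_succ, coef_sub this (this.steklovDot h), coef_steklovDot this hh, ih]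
    ring

/-- The symbol of the centred Steklov average. -/
noncomputable def centredSymbol (h : ℝ) (k : ℤ) : ℂ :=
  (h : ℂ)⁻¹ * ∫ t in (-(h / 2))..(h / 2), Complex.exp (Complex.I * k * t)

theorem steklov_trigSum (M : ℕ) (c : ℤ → ℂ) (h x : ℝ) :
    steklov h (trigSum M c) x = trigSum M (fun k => c k * centredSymbol h k) x := by
  simp only [steklov, trigSum, centredSymbol]
  rw [intervalIntegral.integral_finsetSum
    fun k _ => Continuous.intervalIntegrable (by fun_prop) _ _, Finset.mul_sum]
  refine Finset.sum_congr rfl fun k _ => ?_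
  have := intervalIntegral.integral_comp_add_right (a := -(h / 2)) (b := h / 2)
    (fun t : ℝ => Complex.exp (Complex.I * k * t)) x
  rw [show -(h / 2) + x = x - h / 2 by ring, show h / 2 + x = x + h / 2 by ring] at this
  rw [intervalIntegral.integral_const_mul, ← this]
  have e : ∀ t : ℝ, Complex.exp (Complex.I * k * ((t + x : ℝ) : ℂ)) =
      Complex.exp (Complex.I * k * t) * Complex.exp (Complex.I * k * x) := fun t => by
    rw [← Complex.exp_add]; congr 1; push_cast; ring
  simp only [e, intervalIntegral.integral_mul_const]
  ring

theorem subSteklovPow_trigSum (M : ℕ) (c : ℤ → ℂ) (h : ℝ) (r : ℕ) :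
    subSteklovPow h r (trigSum M c) =
      trigSum M (fun k => (1 - centredSymbol h k) ^ r * c k) := by
  induction r with
  | zero => simp [subSteklovPow]
  | succ r ih =>
    rw [subSteklovPow_succ, ih, funext (steklov_trigSum M _ h), trigSum_sub]
    congr 1
    funext k
    ring

theorem steklovDot_trigSum (M : ℕ) (c : ℤ → ℂ) (h : ℝ) :
    steklovDot h (trigSum M c) = trigSum M (fun k => c k * steklovSymbol h k) := by
  funext x
  rw [steklovDot_eq]
  simp only [trigSum, steklovSymbol]
  rw [intervalIntegral.integral_finsetSum
    fun k _ => Continuous.intervalIntegrable (by fun_prop) _ _, Finset.mul_sum]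
  refine Finset.sum_congr rfl fun k _ => ?_
  have := intervalIntegral.integral_comp_add_right (a := 0) (b := h)
    (fun t : ℝ => Complex.exp (Complex.I * k * t)) x
  rw [zero_add, add_comm h x] at this
  rw [intervalIntegral.integral_const_mul, ← this]
  have e : ∀ t : ℝ, Complex.exp (Complex.I * k * ((t + x : ℝ) : ℂ)) =
      Complex.exp (Complex.I * k * t) * Complex.exp (Complex.I * k * x) := fun t => by
    rw [← Complex.exp_add]; congr 1; push_cast; ring
  simp only [e, intervalIntegral.integral_mul_const]
  ring

theorem subSteklovDotPow_trigSum (M : ℕ) (c : ℤ → ℂ) (h : ℝ) (s : ℕ) :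
    subSteklovDotPow h s (trigSum M c) =
      trigSum M (fun k => (1 - steklovSymbol h k) ^ s * c k) := by
  induction s with
  | zero => simp [subSteklovDotPow]
  | succ s ih =>
    rw [subSteklovDotPow_succ, ih, steklovDot_trigSum, trigSum_sub]
    congr 1
    funext k
    ring

/-! ### Fourier multipliers as convolutions, and decay of their kernels. -/

theorem fourierMult_apply {f : ℝ → ℂ} (hf : PeriodicIntegrable f) (M : ℕ) (c : ℤ → ℂ) (x : ℝ) :
    fourierMult M c f x =
      (2 * Real.pi : ℂ)⁻¹ * ∫ t in (-Real.pi)..Real.pi, f (x + t) * trigSum M c (-t) := by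
  have hper : Function.Periodic (fun t => f t * trigSum M c (x - t)) (2 * Real.pi) := fun t => by
    have := periodic_trigSum M c (x - (t + 2 * Real.pi))
    simp only [hf.1 t, ← this]
    congr 2
    ring
  have h3 := intervalIntegral.integral_comp_add_left (a := -Real.pi) (b := Real.pi)
    (fun t => f t * trigSum M c (x - t)) x
  have h4 := hper.intervalIntegral_add_eq (x + -Real.pi) (-Real.pi)
  rw [show x + -Real.pi + 2 * Real.pi = x + Real.pi by ring,
    show -Real.pi + 2 * Real.pi = Real.pi by ring] at h4
  rw [h4] at h3
  simp only [sub_add_cancel_left] at h3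
  rw [h3]
  simp only [fourierMult, trigSum, coef, Finset.mul_sum]
  rw [intervalIntegral.integral_finsetSum fun k _ => hf.mul_continuous (by fun_prop) _ _,
    Finset.mul_sum]
  refine Finset.sum_congr rfl fun k _ => ?_
  rw [mul_left_comm, mul_assoc, ← intervalIntegral.integral_const_mul,
    ← intervalIntegral.integral_mul_const]
  congr 2
  funext t
  rw [show Complex.I * k * ((x - t : ℝ) : ℂ) = Complex.I * k * x + -(Complex.I * k * t) by
    push_cast; ring, Complex.exp_add]
  ring

theorem norm_fourierMult_le {f : ℝ → ℂ} (hf : PeriodicIntegrable f) (M : ℕ) (c : ℤ → ℂ) (x : ℝ) :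
    ‖fourierMult M c f x‖ ≤
      (2 * Real.pi)⁻¹ * ∫ t in (-Real.pi)..Real.pi, ‖f (x + t)‖ * ‖trigSum M c (-t)‖ := by
  have hpi := Real.pi_pos
  rw [fourierMult_apply hf, norm_mul, norm_inv]
  have : ‖(2 * Real.pi : ℂ)‖ = 2 * Real.pi := by
    simp [abs_of_pos hpi]
  rw [this]
  refine mul_le_mul_of_nonneg_left ?_ (by positivity)
  refine (intervalIntegral.norm_integral_le_integral_norm (by linarith)).trans_eq ?_
  simp only [norm_mul]

theorem hasSum_trigSum {M : ℕ} {c : ℤ → ℂ} (hc : ∀ k, (M : ℤ) < |k| → c k = 0) (t : ℝ) :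
    HasSum (fun k : ℤ => c k * Complex.exp (Complex.I * k * t)) (trigSum M c t) := by
  refine hasSum_sum_of_ne_finset_zero fun k hk => ?_
  rw [hc k, zero_mul]
  by_contra! h
  exact hk (Finset.mem_Icc.2 (abs_le.1 h))

/-- Backward differences with step `δ`. -/
def backwardDiff {G : Type*} [AddGroup G] (δ : G) (F : G → ℂ) : G → ℂ := fun y => F y - F (y - δ)

theorem backwardDiff_eq_zero {M : ℕ} {c : ℤ → ℂ} (hc : ∀ k, (M : ℤ) < |k| → c k = 0) (k : ℤ)
    (hk : ((M + 1 : ℕ) : ℤ) < |k|) : backwardDiff 1 c k = 0 := by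
  push_cast at hk
  have h2 : (M : ℤ) < |k - 1| := by
    have := abs_sub_abs_le_abs_sub k 1
    rw [abs_one] at this
    linarith
  rw [backwardDiff, hc k (by linarith), hc _ h2, sub_zero]

/-- Summation by parts. Since `c` vanishes beyond `M` there is no boundary term, but the differenced
sequence reaches one frequency further. -/
theorem one_sub_exp_mul_trigSum {M : ℕ} {c : ℤ → ℂ} (hc : ∀ k, (M : ℤ) < |k| → c k = 0) (t : ℝ) :
    (1 - Complex.exp (Complex.I * t)) * trigSum M c t = trigSum (M + 1) (backwardDiff 1 c) t := by
  have h1 := hasSum_trigSum hc t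
  have h2 := (Equiv.subRight (1 : ℤ)).hasSum_iff.2 h1
  have h3 := h1.sub (h2.mul_left (Complex.exp (Complex.I * t)))
  have h4 := hasSum_trigSum (backwardDiff_eq_zero hc) t
  rw [one_sub_mul]
  refine h3.unique ?_
  refine h4.congr_fun ?_
  intro k
  simp only [backwardDiff, Function.comp, Equiv.subRight_apply]
  rw [mul_left_comm, ← Complex.exp_add, sub_mul]
  congr 3
  push_cast
  ring

theorem one_sub_exp_pow_mul_trigSum {M : ℕ} {c : ℤ → ℂ} (hc : ∀ k, (M : ℤ) < |k| → c k = 0)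
    (t : ℝ) (j : ℕ) : (1 - Complex.exp (Complex.I * t)) ^ j * trigSum M c t =
      trigSum (M + j) ((backwardDiff 1)^[j] c) t := by
  induction j generalizing M c with
  | zero => simp
  | succ j ih =>
    rw [pow_succ, mul_assoc, one_sub_exp_mul_trigSum hc, ih (backwardDiff_eq_zero hc),
      Function.iterate_succ_apply, show M + 1 + j = M + (j + 1) by ring]

theorem norm_trigSum_le {M : ℕ} {c : ℤ → ℂ} {S : ℝ} (hc : ∀ k, ‖c k‖ ≤ S) (t : ℝ) :
    ‖trigSum M c t‖ ≤ (2 * M + 1) * S := by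
  refine (norm_sum_le_of_le (n := fun _ => S) _ fun k _ => ?_).trans_eq ?_
  · rw [norm_mul, show Complex.I * k * t = ((k * t : ℝ) : ℂ) * Complex.I by push_cast; ring,
      Complex.norm_exp_ofReal_mul_I, mul_one]
    exact hc k
  · rw [Finset.sum_const, Int.card_Icc, nsmul_eq_mul]
    congr 1
    rw [show ((M : ℤ) + 1 - -(M : ℤ)).toNat = 2 * M + 1 by omega]
    push_cast
    ring

/-- Each difference costs one derivative by the mean value inequality and gains a factor `δ`. With
`δ = 1/n` and `j = 3` this produces the cubic decay of the kernels. -/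
theorem norm_backwardDiff_iterate_le {δ : ℝ} (hδ : 0 ≤ δ) (j : ℕ) {F : ℝ → ℂ} (hF : ContDiff ℝ j F)
    {S : ℝ} (hS : ∀ y, ‖iteratedDeriv j F y‖ ≤ S) (y : ℝ) :
    ‖(backwardDiff δ)^[j] F y‖ ≤ δ ^ j * S := by
  induction j generalizing F S y with
  | zero => simpa using hS y
  | succ j ih =>
    rw [Function.iterate_succ_apply]
    have hFj : ContDiff ℝ j F := hF.of_le (by exact_mod_cast Nat.le_succ j)
    have hsh : ContDiff ℝ j fun y => F (y - δ) := hFj.comp (contDiff_id.sub contDiff_const)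
    have hd : Differentiable ℝ (iteratedDeriv j F) := hF.differentiable_iteratedDeriv j
      (by exact_mod_cast Nat.lt_succ_self j)
    refine (ih (S := δ * S) (hFj.sub hsh) (fun z => ?_) y).trans_eq (by ring)
    have e : iteratedDeriv j (backwardDiff δ F) z =
        iteratedDeriv j F z - iteratedDeriv j F (z - δ) := by
      have := iteratedDeriv_fun_sub (n := j) (x := z) hFj.contDiffAt hsh.contDiffAt
      rw [iteratedDeriv_comp_sub_const] at this
      exact this
    refine (congrArg norm e).trans_le ?_
    have := convex_univ.norm_image_sub_le_of_norm_deriv_le (f := iteratedDeriv j F) (C := S)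
      (fun x _ => hd x) (fun x _ => by rw [← iteratedDeriv_succ]; exact hS x)
      (mem_univ (z - δ)) (mem_univ z)
    refine this.trans_eq ?_
    rw [sub_sub_cancel, Real.norm_of_nonneg hδ, mul_comm]

theorem backwardDiff_iterate_comp (δ : ℝ) (F : ℝ → ℂ) (j : ℕ) :
    (backwardDiff 1)^[j] (fun k : ℤ => F (k * δ)) = fun k : ℤ => (backwardDiff δ)^[j] F (k * δ) := by
  induction j generalizing F with
  | zero => rfl
  | succ j ih =>
    simp only [Function.iterate_succ_apply]
    rw [← ih]
    congr 1
    funext k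
    simp [backwardDiff, sub_mul]

/-- Jordan's inequality, applied to `|1 - e^{it}| = 2|sin(t/2)|`. -/
theorem two_div_pi_mul_abs_le_norm {t : ℝ} (ht : |t| ≤ Real.pi) :
    2 / Real.pi * |t| ≤ ‖1 - Complex.exp (Complex.I * t)‖ := by
  rw [norm_sub_rev, Complex.norm_exp_I_mul_ofReal_sub_one, norm_mul, Real.norm_eq_abs,
    Real.norm_eq_abs, abs_two]
  have h := Real.mul_le_sin (x := |t| / 2) (by positivity) (by linarith)
  have h2 : Real.sin (|t| / 2) ≤ |Real.sin (t / 2)| := by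
    rcases abs_cases t with ⟨h, _⟩ | ⟨h, _⟩ <;> rw [h]
    · exact le_abs_self _
    · rw [neg_div, Real.sin_neg]; exact neg_le_abs _
  linarith

/-- Decay of the kernel `∑ F(k/n) e^{ikt}` for a `C³` function `F` with compact support. -/
theorem exists_kernel_bound {F : ℝ → ℂ} (hF : ContDiff ℝ 3 F) {R : ℕ}
    (hR : ∀ y : ℝ, (R : ℝ) < |y| → F y = 0) :
    ∃ B ≥ 0, ∀ n : ℕ, 1 ≤ n → ∀ M : ℕ, R * n ≤ M → ∀ t : ℝ, |t| ≤ Real.pi →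
      ‖trigSum M (fun k => F (k / n)) t‖ ≤ B * n ∧
      ‖trigSum M (fun k => F (k / n)) t‖ * (n * |t|) ^ 3 ≤ B * n := by
  have hcs : HasCompactSupport F := by
    refine HasCompactSupport.intro (isCompact_Icc (a := -(R : ℝ)) (b := R)) fun y hy => hR y ?_
    by_contra! h
    exact hy (abs_le.1 h)
  obtain ⟨S₀, hS₀⟩ := hF.continuous.bounded_above_of_compact_support hcs
  obtain ⟨S₃, hS₃⟩ : ∃ S, ∀ y, ‖iteratedDeriv 3 F y‖ ≤ S := by
    obtain ⟨S, hS⟩ := (hF.continuous_iteratedFDeriv le_rfl).bounded_above_of_compact_support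
      (hcs.iteratedFDeriv 3)
    exact ⟨S, fun y => by
      rw [← norm_iteratedFDeriv_eq_norm_iteratedDeriv]; exact_mod_cast hS y⟩
  have hS₀' := (norm_nonneg _).trans (hS₀ 0)
  have hS₃' := (norm_nonneg _).trans (hS₃ 0)
  have hpi := Real.pi_pos
  -- `(2R + 7)n` bounds the number of frequencies even after three differences, namely `2(Rn + 3) +
  -- 1`; `(π/2)³` comes from dividing by `|1 - e^{it}|³`.
  refine ⟨(2 * R + 7) * S₀ + (Real.pi / 2) ^ 3 * ((2 * R + 7) * S₃), by positivity,
    fun n hn M hM t ht => ?_⟩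
  have hn1 : (1 : ℝ) ≤ n := by exact_mod_cast hn
  have hn0 : (0 : ℝ) < n := by linarith
  have hz : ∀ k : ℤ, ((R * n : ℕ) : ℤ) < |k| → F (k / n) = 0 := fun k hk => by
    refine hR _ ?_
    rw [abs_div, abs_of_pos hn0, lt_div_iff₀ hn0]
    exact_mod_cast hk
  rw [trigSum_extend hM hz]
  have hRn : (2 * ((R * n + 3 : ℕ) : ℝ) + 1) ≤ (2 * R + 7) * n := by
    push_cast
    nlinarith
  have hRn' : (2 * ((R * n : ℕ) : ℝ) + 1) ≤ (2 * R + 7) * n := by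
    push_cast
    nlinarith
  have b1 : ‖trigSum (R * n) (fun k => F (k / n)) t‖ ≤ (2 * R + 7) * S₀ * n := by
    refine (norm_trigSum_le (fun k => hS₀ _) t).trans ?_
    calc _ ≤ (2 * R + 7) * n * S₀ := by gcongr
      _ = _ := by ring
  have b2 : ‖trigSum (R * n) (fun k => F (k / n)) t‖ * (n * |t|) ^ 3 ≤
      (Real.pi / 2) ^ 3 * ((2 * R + 7) * S₃) * n := by
    have h1 := one_sub_exp_pow_mul_trigSum hz t 3
    simp only [div_eq_mul_inv] at h1
    rw [backwardDiff_iterate_comp] at h1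
    have h2 := norm_trigSum_le (M := R * n + 3)
      (fun k : ℤ => norm_backwardDiff_iterate_le (inv_nonneg.2 hn0.le) 3 hF hS₃ (k * (n : ℝ)⁻¹)) t
    rw [← h1, norm_mul, norm_pow] at h2
    have h3 : (2 / Real.pi * |t|) ^ 3 ≤ ‖1 - Complex.exp (Complex.I * t)‖ ^ 3 := by
      gcongr
      exact two_div_pi_mul_abs_le_norm ht
    simp only [div_eq_mul_inv (_ : ℝ) (n : ℝ)]
    set N := ‖trigSum (R * n) (fun k => F (k * (n : ℝ)⁻¹)) t‖
    have hN : 0 ≤ N := norm_nonneg _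
    calc N * (n * |t|) ^ 3 = (Real.pi / 2) ^ 3 * n ^ 3 * ((2 / Real.pi * |t|) ^ 3 * N) := by
          field_simp
      _ ≤ (Real.pi / 2) ^ 3 * n ^ 3 * ((2 * R + 7) * n * ((n : ℝ)⁻¹ ^ 3 * S₃)) := by
          refine mul_le_mul_of_nonneg_left ?_ (by positivity)
          refine (mul_le_mul_of_nonneg_right h3 hN).trans (h2.trans ?_)
          gcongr
      _ = _ := by field_simp
  constructor
  · refine b1.trans ?_
    have : 0 ≤ (Real.pi / 2) ^ 3 * ((2 * R + 7) * S₃) * n := by positivity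
    linarith
  · refine b2.trans ?_
    have : 0 ≤ (2 * R + 7) * S₀ * n := by positivity
    linarith

/-- Take the least `j` with `n|t| ≤ 2ʲ`. If `j > 0`, minimality gives `n|t| > 2ʲ⁻¹`, and the cubic
decay yields the weight `8 · 8⁻ʲ`; if `j = 0`, the plain bound suffices. Such a `j` exists below `n
+ 3` because `πn ≤ 4 · 2ⁿ`; this crude range is harmless, as the weights are summable. -/
theorem le_sum_indicator_of_decay {κ B : ℝ} (hκ : 0 ≤ κ) {n : ℕ} (hn : 1 ≤ n) {t : ℝ}
    (ht : |t| ≤ Real.pi) (h0 : κ ≤ B * n) (h3 : κ * (n * |t|) ^ 3 ≤ B * n) :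
    κ ≤ 8 * B * n * ∑ j ∈ Finset.range (n + 3), (1 / 8 : ℝ) ^ j *
      (Icc (-(2 ^ j / n : ℝ)) (2 ^ j / n)).indicator (fun _ => (1 : ℝ)) t := by
  have hn0 : (0 : ℝ) < n := by exact_mod_cast hn
  have hBn : 0 ≤ B * n := hκ.trans h0
  have hex : n * |t| ≤ 2 ^ (n + 2) := by
    have : (n : ℝ) ≤ 2 ^ n := by exact_mod_cast Nat.lt_two_pow_self.le
    calc n * |t| ≤ 2 ^ n * 4 := by
          gcongr
          linarith [Real.pi_le_four]
      _ = _ := by ring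
  have hex' : ∃ j : ℕ, n * |t| ≤ 2 ^ j := ⟨_, hex⟩
  classical
  set j := Nat.find hex' with hj
  have hj1 : n * |t| ≤ 2 ^ j := Nat.find_spec hex'
  have hj2 : j ≤ n + 2 := Nat.find_min' hex' hex
  have hmem : t ∈ Icc (-(2 ^ j / n : ℝ)) (2 ^ j / n) := by
    rw [mem_Icc, ← abs_le, le_div_iff₀ hn0, mul_comm]
    exact hj1
  have hterm : κ ≤ 8 * B * n * ((1 / 8 : ℝ) ^ j *
      (Icc (-(2 ^ j / n : ℝ)) (2 ^ j / n)).indicator (fun _ => (1 : ℝ)) t) := by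
    rw [indicator_of_mem hmem, mul_one]
    rcases Nat.eq_zero_or_pos j with hj0 | hj0
    · rw [hj0]; linarith
    · obtain ⟨i, hi⟩ := Nat.exists_eq_succ_of_ne_zero hj0.ne'
      have hlt : 2 ^ i < n * |t| := by
        by_contra! h
        have := Nat.find_min' hex' h
        omega
      have h4 : κ * (2 ^ i) ^ 3 ≤ B * n :=
        (mul_le_mul_of_nonneg_left (by gcongr) hκ).trans h3
      have e8 : ((2 : ℝ) ^ i) ^ 3 = 8 ^ i := by
        rw [← pow_mul, mul_comm, pow_mul]
        norm_num
      rw [e8, ← le_div_iff₀ (by positivity)] at h4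
      rw [hi]
      refine h4.trans_eq ?_
      rw [Nat.succ_eq_add_one, pow_succ, one_div_pow]
      ring
  refine hterm.trans ?_
  refine mul_le_mul_of_nonneg_left ?_ (by linarith)
  refine Finset.single_le_sum (f := fun j => (1 / 8 : ℝ) ^ j *
    (Icc (-(2 ^ j / n : ℝ)) (2 ^ j / n)).indicator (fun _ => (1 : ℝ)) t) (fun i _ => ?_)
    (Finset.mem_range.2 (by omega))
  exact mul_nonneg (by positivity) (indicator_nonneg (fun _ _ => zero_le_one) _)

theorem integral_mul_le_of_decay {K : ℝ → ℂ} (hK : Continuous K) {B : ℝ} (hB : 0 ≤ B) {n : ℕ}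
    (hn : 1 ≤ n)
    (hdecay : ∀ t, |t| ≤ Real.pi → ‖K t‖ ≤ B * n ∧ ‖K t‖ * (n * |t|) ^ 3 ≤ B * n)
    {q : ℝ → ℝ} (hq : ∀ t, 0 ≤ q t) (hqi : ∀ a b, IntervalIntegrable q volume a b) :
    ∫ t in (-Real.pi)..Real.pi, q t * ‖K (-t)‖ ≤
      8 * B * n * ∑ j ∈ Finset.range (n + 3), (1 / 8 : ℝ) ^ j *
        ∫ t in (-(2 ^ j / n : ℝ))..(2 ^ j / n), q t := by
  have hpi := Real.pi_pos
  have hind : ∀ j : ℕ, IntervalIntegrable (fun t => q t *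
      (Icc (-(2 ^ j / n : ℝ)) (2 ^ j / n)).indicator (fun _ => (1 : ℝ)) t) volume
        (-Real.pi) Real.pi := fun j => by
    have e : (fun t => q t * (Icc (-(2 ^ j / n : ℝ)) (2 ^ j / n)).indicator (fun _ => (1 : ℝ)) t) =
        (Icc (-(2 ^ j / n : ℝ)) (2 ^ j / n)).indicator q := by
      funext t
      by_cases h : t ∈ Icc (-(2 ^ j / n : ℝ)) (2 ^ j / n) <;> simp [h]
    rw [e]
    exact ⟨(hqi _ _).1.indicator measurableSet_Icc, (hqi _ _).2.indicator measurableSet_Icc⟩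
  have hle : ∫ t in (-Real.pi)..Real.pi, q t * ‖K (-t)‖ ≤
      ∫ t in (-Real.pi)..Real.pi, 8 * B * n * ∑ j ∈ Finset.range (n + 3), (1 / 8 : ℝ) ^ j *
        (q t * (Icc (-(2 ^ j / n : ℝ)) (2 ^ j / n)).indicator (fun _ => (1 : ℝ)) t) := by
    refine intervalIntegral.integral_mono_on (by linarith)
      ((hqi _ _).mul_continuousOn (by fun_prop)) ?_ fun t ht => ?_
    · refine IntervalIntegrable.const_mul ?_ _
      have := IntervalIntegrable.sum (μ := volume) (a := -Real.pi) (b := Real.pi)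
        (Finset.range (n + 3)) (f := fun j t => (1 / 8 : ℝ) ^ j *
          (q t * (Icc (-(2 ^ j / n : ℝ)) (2 ^ j / n)).indicator (fun _ => (1 : ℝ)) t))
        fun j _ => (hind j).const_mul _
      simpa [Finset.sum_fn] using this
    · have ht' : |t| ≤ Real.pi := abs_le.2 ht
      have := hdecay (-t) (by rwa [abs_neg])
      rw [abs_neg] at this
      have h := le_sum_indicator_of_decay (norm_nonneg _) hn ht' this.1 this.2
      refine (mul_le_mul_of_nonneg_left h (hq t)).trans_eq ?_
      rw [mul_left_comm, Finset.mul_sum]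
      congr 1
      exact Finset.sum_congr rfl fun j _ => by ring
  refine hle.trans ?_
  rw [intervalIntegral.integral_const_mul]
  refine mul_le_mul_of_nonneg_left ?_ (by positivity)
  rw [intervalIntegral.integral_finsetSum fun j _ => (hind j).const_mul _]
  refine Finset.sum_le_sum fun j _ => ?_
  rw [intervalIntegral.integral_const_mul]
  refine mul_le_mul_of_nonneg_left ?_ (by positivity)
  have hj : (0 : ℝ) ≤ 2 ^ j / n := by positivity
  rw [intervalIntegral.integral_of_le (by linarith : -Real.pi ≤ Real.pi),
    intervalIntegral.integral_of_le (by linarith : -(2 ^ j / n : ℝ) ≤ 2 ^ j / n),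
    ← integral_Icc_eq_integral_Ioc (x := -(2 ^ j / n : ℝ))]
  have e : ∀ t, q t * (Icc (-(2 ^ j / n : ℝ)) (2 ^ j / n)).indicator (fun _ => (1 : ℝ)) t =
      (Icc (-(2 ^ j / n : ℝ)) (2 ^ j / n)).indicator q t := fun t => by
    by_cases h : t ∈ Icc (-(2 ^ j / n : ℝ)) (2 ^ j / n) <;> simp [h]
  simp only [e]
  rw [setIntegral_indicator measurableSet_Icc]
  refine setIntegral_mono_set ?_ (Eventually.of_forall fun t => hq t)
    (Eventually.of_forall fun t ht => ht.2)
  rw [integrableOn_Icc_iff_integrableOn_Ioc]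
  exact (hqi _ _).1

theorem norm_fourierMult_le_sum {f : ℝ → ℂ} (hf : PeriodicIntegrable f) {M : ℕ} {c : ℤ → ℂ} {B : ℝ}
    (hB : 0 ≤ B) {n : ℕ} (hn : 1 ≤ n)
    (hdecay : ∀ t, |t| ≤ Real.pi → ‖trigSum M c t‖ ≤ B * n ∧
      ‖trigSum M c t‖ * (n * |t|) ^ 3 ≤ B * n) (x : ℝ) :
    ‖fourierMult M c f x‖ ≤ 2 * B * n * ∑ j ∈ Finset.range (n + 3), (1 / 8 : ℝ) ^ j *
        ∫ t in (-(2 ^ j / n : ℝ))..(2 ^ j / n), ‖f (x + t)‖ := by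
  have hpi := Real.pi_gt_three
  have hi : ∀ a b, IntervalIntegrable (fun t => ‖f (x + t)‖) volume a b := fun a b => by
    have := (hf.2 (x + a) (x + b)).comp_add_left x
    simpa using this.norm
  refine (norm_fourierMult_le hf M c x).trans ?_
  have h := integral_mul_le_of_decay (continuous_trigSum M c) hB hn hdecay
    (fun t => norm_nonneg (f (x + t))) hi
  have h0 : 0 ≤ ∑ j ∈ Finset.range (n + 3), (1 / 8 : ℝ) ^ j *
        ∫ t in (-(2 ^ j / n : ℝ))..(2 ^ j / n), ‖f (x + t)‖ := Finset.sum_nonneg fun j _ => by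
    have hj : (0 : ℝ) ≤ 2 ^ j / n := by positivity
    exact mul_nonneg (by positivity)
      (intervalIntegral.integral_nonneg (by linarith) fun _ _ => norm_nonneg _)
  have h1 : (2 * Real.pi)⁻¹ ≤ 1 / 4 := by
    rw [inv_le_comm₀ (by positivity) (by norm_num)]
    linarith
  refine (mul_le_mul_of_nonneg_left h (by positivity)).trans ?_
  refine (mul_le_mul_of_nonneg_right h1 (by positivity)).trans_eq (by ring)

/-! ### Boundedness of multipliers on the lattice and a Jackson estimate. -/

namespace TorusBanachLattice

variable {X : TorusBanachLattice} {K : ℝ}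

/-- The weight `8⁻ʲ` times the window length `2 · 2ʲ/n` leaves a geometric series of ratio `1/4`. -/
theorem SteklovBoundedBy.nrm_fourierMult_le (hK : X.SteklovBoundedBy K) {f : ℝ → ℂ}
    (hf : f ∈ X.carrier) {M : ℕ} {c : ℤ → ℂ} {B : ℝ} (hB : 0 ≤ B) {n : ℕ} (hn : 1 ≤ n)
    (hdecay : ∀ t, |t| ≤ Real.pi → ‖trigSum M c t‖ ≤ B * n ∧
      ‖trigSum M c t‖ * (n * |t|) ^ 3 ≤ B * n) :
    X.nrm (fourierMult M c f) ≤ 8 * B * K * X.nrm f := by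
  have hn0 : (0 : ℝ) < n := by exact_mod_cast hn
  have hf' := periodicIntegrable hf
  have h := hK.nrm_le_of_le_sum (g := fourierMult M c f) hf (fun j => 4 * B * (1 / 4 : ℝ) ^ j)
    (fun j => 2 * (2 ^ j / n)) (fun j => by positivity) (fun j => by positivity) (n + 3)
    (periodic_trigSum _ _) (continuous_trigSum _ _).measurable.aemeasurable fun x => by
      refine (norm_fourierMult_le_sum hf' hB hn hdecay x).trans_eq ?_
      rw [Finset.mul_sum]
      refine Finset.sum_congr rfl fun j _ => ?_
      have := intervalIntegral.integral_comp_add_left (a := -(2 ^ j / n : ℝ)) (b := 2 ^ j / n)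
        (fun t => ‖f t‖) x
      rw [this, absAvg, mul_div_cancel_left₀ _ (two_ne_zero' ℝ), ← sub_eq_add_neg,
        show (8 : ℝ) = 4 * 2 by norm_num, ← one_div_mul_one_div, mul_pow (1 / 4 : ℝ), one_div_pow (2 : ℝ)]
      field_simp
      ring
  refine h.2.trans ?_
  rw [← Finset.mul_sum]
  have hs : ∑ j ∈ Finset.range (n + 3), (1 / 4 : ℝ) ^ j ≤ 2 := by
    rw [geom_sum_eq (by norm_num), div_le_iff_of_neg (by norm_num)]
    have : (0 : ℝ) ≤ (1 / 4) ^ (n + 3) := by positivity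
    linarith
  have h0 := mul_nonneg hK.1 (X.nrm_nonneg f hf)
  calc _ ≤ 4 * B * 2 * (K * X.nrm f) := by gcongr
    _ = _ := by ring

/-- Because `c 0 = 1` the multiplier fixes constants, so at each `x` it may be applied to `G -
G(x)`, whose increments are integrals of `G'`. This costs one more factor `2ʲ/n`: the ratio becomes
`1/2` and a factor `1/n` is gained. Cubic decay of the kernel leaves just enough room. -/
theorem SteklovBoundedBy.nrm_sub_fourierMult_le (hK : X.SteklovBoundedBy K) {G G' : ℝ → ℂ}
    (hG : ∀ y, HasDerivAt G (G' y) y) (hper : Function.Periodic G (2 * Real.pi))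
    (hG' : G' ∈ X.carrier) {M : ℕ} {c : ℤ → ℂ} (hc : c 0 = 1) {B : ℝ} (hB : 0 ≤ B) {n : ℕ}
    (hn : 1 ≤ n)
    (hdecay : ∀ t, |t| ≤ Real.pi → ‖trigSum M c t‖ ≤ B * n ∧
      ‖trigSum M c t‖ * (n * |t|) ^ 3 ≤ B * n) :
    X.nrm (G - fourierMult M c G) ≤ 16 * B * K / n * X.nrm G' := by
  have hn0 : (0 : ℝ) < n := by exact_mod_cast hn
  have hcont : Continuous G := continuous_iff_continuousAt.2 fun y => (hG y).continuousAt
  have hGi := PeriodicIntegrable.of_continuous hcont hper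
  have hG'i := periodicIntegrable hG'
  have hconst : ∀ v : ℂ, fourierMult M c (fun _ => v) = fun _ => v := fun v => by
    have e : (fun _ : ℝ => v) = trigSum 0 (fun _ => v) := by
      funext x; simp [trigSum]
    rw [e, fourierMult]
    simp only [coef_trigSum]
    rw [trigSum_extend (Nat.zero_le M) (fun k hk => by
      rw [if_neg (not_le.2 hk), mul_zero])]
    refine trigSum_congr fun k hk => ?_
    rw [if_pos hk]
    have : k = 0 := by simpa using hk
    rw [this, hc, one_mul]
  have hsub : ∀ x, (G - fourierMult M c G) x = - fourierMult M c (G - fun _ => G x) x := fun x => by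
    have e : fourierMult M c (G - fun _ => G x) =
        fourierMult M c G - fourierMult M c (fun _ => G x) := by
      simp only [fourierMult, trigSum_sub, coef_sub hGi (.const _), mul_sub]
    rw [e, hconst]
    simp
  have h := hK.nrm_le_of_le_sum (g := G - fourierMult M c G) hG'
    (fun j => 8 * B / n * (1 / 2 : ℝ) ^ j)
    (fun j => 2 * (2 ^ j / n)) (fun j => by positivity) (fun j => by positivity) (n + 3)
    (hper.sub (periodic_trigSum _ _))
    (hcont.sub (continuous_trigSum _ _)).measurable.aemeasurable fun x => by
      rw [hsub, norm_neg]
      refine (norm_fourierMult_le_sum (hGi.sub (.const (G x))) hB hn hdecay x).trans ?_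
      rw [Finset.mul_sum]
      refine Finset.sum_le_sum fun j _ => ?_
      have hj : (0 : ℝ) < 2 ^ j / n := by positivity
      have h1 : ∫ t in (-(2 ^ j / n : ℝ))..(2 ^ j / n), ‖G (x + t) - G x‖ ≤
          (2 * (2 ^ j / n)) * ((2 * (2 ^ j / n)) * absAvg (2 * (2 ^ j / n)) G' x) := by
        have := intervalIntegral.norm_integral_le_of_norm_le_const
          (a := -(2 ^ j / n : ℝ)) (b := 2 ^ j / n)
          (f := fun t => ‖G (x + t) - G x‖)
          (C := (2 * (2 ^ j / n)) * absAvg (2 * (2 ^ j / n)) G' x) fun t ht => by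
            rw [uIoc_of_le (by linarith)] at ht
            rw [norm_norm]
            refine norm_sub_le_absAvg hG hG'i (by positivity) ?_ ?_
            · rw [add_sub_cancel_left, abs_le]
              constructor <;> linarith [ht.1, ht.2]
            · simp [hj.le]
        refine (le_abs_self _).trans (this.trans_eq ?_)
        rw [abs_of_pos (by linarith)]
        ring
      calc _ = 2 * B * n * ((1 / 8 : ℝ) ^ j *
            ∫ t in (-(2 ^ j / n : ℝ))..(2 ^ j / n), ‖G (x + t) - G x‖) := rfl
        _ ≤ 2 * B * n * ((1 / 8 : ℝ) ^ j *
            ((2 * (2 ^ j / n)) * ((2 * (2 ^ j / n)) * absAvg (2 * (2 ^ j / n)) G' x))) := by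
            gcongr
        _ = _ := by
          rw [show (8 : ℝ) = 2 * 2 * 2 by norm_num, ← one_div_mul_one_div, ← one_div_mul_one_div,
            mul_pow, mul_pow, one_div_pow (2 : ℝ)]
          field_simp
  refine h.2.trans ?_
  rw [← Finset.mul_sum]
  have hs : ∑ j ∈ Finset.range (n + 3), (1 / 2 : ℝ) ^ j ≤ 2 := by
    rw [geom_sum_eq (by norm_num), div_le_iff_of_neg (by norm_num)]
    have : (0 : ℝ) ≤ (1 / 2) ^ (n + 3) := by positivity
    linarith
  have h0 := mul_nonneg hK.1 (X.nrm_nonneg G' hG')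
  calc _ ≤ 8 * B / n * 2 * (K * X.nrm G') := by gcongr
    _ = _ := by ring

end TorusBanachLattice

/-! ### The symbol of `I - Ȧ_h` and a smooth cutoff. -/

/-- The entire function `(e^z - 1 - z) / z²`. -/
noncomputable def expQuotient : ℂ → ℂ := dslope (dslope Complex.exp 0) 0

theorem differentiable_expQuotient : Differentiable ℂ expQuotient := by
  have h : ∀ f : ℂ → ℂ, Differentiable ℂ f → Differentiable ℂ (dslope f 0) := fun f hf => by
    rw [← differentiableOn_univ] at hf ⊢
    exact (Complex.differentiableOn_dslope univ_mem).2 hf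
  exact h _ (h _ Complex.differentiable_exp)

theorem dslope_exp_eq (z : ℂ) : dslope Complex.exp 0 z = 1 + z * expQuotient z := by
  have h1 := sub_smul_dslope (dslope Complex.exp 0) 0 z
  have h2 : dslope Complex.exp 0 0 = 1 := by simp
  rw [h2, sub_zero, smul_eq_mul] at h1
  rw [expQuotient, h1]
  ring

theorem exp_eq_expQuotient (z : ℂ) : Complex.exp z = 1 + z + z ^ 2 * expQuotient z := by
  have h1 := sub_smul_dslope Complex.exp 0 z
  rw [Complex.exp_zero, sub_zero, smul_eq_mul, dslope_exp_eq] at h1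
  linear_combination -h1

/-- For `y ≠ 0` a zero would force `e^{iy} = 1 + iy`, impossible since the moduli differ. At `0`,
the quotient is at least `1/2` along the positive reals, hence also in the limit. -/
theorem expQuotient_ne_zero (y : ℝ) : expQuotient (Complex.I * y) ≠ 0 := by
  intro h
  rcases eq_or_ne y 0 with rfl | hy
  · have hle : ∀ᶠ x : ℝ in 𝓝[>] 0, (1 / 2 : ℝ) ≤ ‖expQuotient (x : ℂ)‖ := by
      filter_upwards [self_mem_nhdsWithin] with x hx
      have hx : (0 : ℝ) < x := hx
      have h1 := exp_eq_expQuotient x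
      have h2 : expQuotient (x : ℂ) = (((Real.exp x - 1 - x) / x ^ 2 : ℝ) : ℂ) := by
        have : (x : ℂ) ≠ 0 := by exact_mod_cast hx.ne'
        push_cast
        rw [h1]
        field_simp
        ring
      rw [h2, Complex.norm_real]
      refine le_trans ?_ (le_abs_self _)
      rw [le_div_iff₀ (by positivity)]
      linarith [Real.quadratic_le_exp_of_nonneg hx.le]
    have ht : Tendsto (fun x : ℝ => ‖expQuotient (x : ℂ)‖) (𝓝[>] 0) (𝓝 ‖expQuotient ((0 : ℝ) : ℂ)‖) :=
      ((differentiable_expQuotient.continuous.comp Complex.continuous_ofReal).norm.tendsto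
        0).mono_left nhdsWithin_le_nhds
    have := ge_of_tendsto ht hle
    rw [show ((0 : ℝ) : ℂ) = Complex.I * (0 : ℝ) by simp, h, norm_zero] at this
    norm_num at this
  · have h1 := exp_eq_expQuotient (Complex.I * y)
    rw [h, mul_zero, add_zero] at h1
    have h2 := congrArg Complex.normSq h1
    rw [Complex.normSq_eq_norm_sq, mul_comm, Complex.norm_exp_ofReal_mul_I] at h2
    simp [Complex.normSq_apply] at h2
    exact hy h2

/-- The symbol is `(e^z - 1)/z` at `z = ikh`. The factorization isolates its deviation from `1` as a
simple zero at `z = 0`, which cancels against the derivative symbol. -/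
theorem one_sub_steklovSymbol {h : ℝ} (hh : h ≠ 0) (k : ℤ) :
    1 - steklovSymbol h k = -(Complex.I * k * h) * expQuotient (Complex.I * k * h) := by
  have hh' : (h : ℂ) ≠ 0 := by exact_mod_cast hh
  have : steklovSymbol h k = dslope Complex.exp 0 (Complex.I * k * h) := by
    rcases eq_or_ne k 0 with rfl | hk
    · simp [steklovSymbol, hh']
    · have hk' : (k : ℂ) ≠ 0 := by exact_mod_cast hk
      have hne : Complex.I * k * h ≠ 0 := by simp [hk, hh]
      rw [dslope_of_ne _ hne, slope_def_field, steklovSymbol,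
        integral_exp_mul_complex (by simp [hk])]
      simp
      field_simp
  rw [this, dslope_exp_eq]
  ring

/-- The function `y ↦ ψ(iγy)` with `ψ(z) = (e^z - 1 - z) / z²`. -/
noncomputable def symbolQuotient (γ y : ℝ) : ℂ := expQuotient (Complex.I * (γ * y : ℝ))

theorem symbolQuotient_ne_zero (γ y : ℝ) : symbolQuotient γ y ≠ 0 := expQuotient_ne_zero _

theorem contDiff_symbolQuotient (γ : ℝ) : ContDiff ℝ 3 (symbolQuotient γ) := by
  have h1 : ContDiff ℝ 3 expQuotient := differentiable_expQuotient.contDiff.restrict_scalars ℝ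
  have h2 : ContDiff ℝ 3 fun y : ℝ => Complex.I * ((γ * y : ℝ) : ℂ) :=
    contDiff_const.mul (Complex.ofRealCLM.contDiff.comp (contDiff_const.mul contDiff_id))
  exact h1.comp h2

theorem one_sub_steklovSymbol_div {γ : ℝ} (hγ : 0 < γ) {n : ℕ} (hn : 1 ≤ n) (k : ℤ) :
    1 - steklovSymbol (γ / n) k =
      -(Complex.I * γ * (k / n : ℝ)) * symbolQuotient γ (k / n) := by
  have hn0 : (0 : ℝ) < n := by exact_mod_cast hn
  have e : Complex.I * k * ((γ / n : ℝ) : ℂ) = Complex.I * ((γ * (k / n) : ℝ) : ℂ) := by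
    push_cast; ring
  rw [one_sub_steklovSymbol (by positivity), e, symbolQuotient]
  push_cast
  ring

theorem exists_cutoff : ∃ η : ℝ → ℂ, ContDiff ℝ 3 η ∧ (∀ y, |y| ≤ 1 / 2 → η y = 1) ∧
    ∀ y, 1 ≤ |y| → η y = 0 := by
  let b : ContDiffBump (0 : ℝ) := ⟨1 / 2, 1, by norm_num, by norm_num⟩
  refine ⟨fun y => (b y : ℂ), Complex.ofRealCLM.contDiff.comp b.contDiff, fun y hy => ?_,
    fun y hy => ?_⟩
  · have : y ∈ Metric.closedBall (0 : ℝ) b.rIn := by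
      rw [Metric.mem_closedBall, Real.dist_eq, sub_zero]
      exact hy
    simp only
    rw [b.one_of_mem_closedBall this, Complex.ofReal_one]
  · have : b.rOut ≤ dist y 0 := by
      rw [Real.dist_eq, sub_zero]
      exact hy
    simp only
    rw [b.zero_of_le_dist this, Complex.ofReal_zero]

theorem hasDerivAt_steklovDot {p : ℝ → ℂ} (hp : Continuous p) (h x : ℝ) :
    HasDerivAt (steklovDot h p) ((h : ℂ)⁻¹ * (p (x + h) - p x)) x := by
  have hi : ∀ a b, IntervalIntegrable p volume a b := fun a b => hp.intervalIntegrable a b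
  have e : steklovDot h p = fun x => (h : ℂ)⁻¹ *
      ((∫ t in (0 : ℝ)..(x + h), p t) - ∫ t in (0 : ℝ)..x, p t) := by
    funext x
    rw [steklovDot_eq, intervalIntegral.integral_interval_sub_left (hi _ _) (hi _ _)]
  have hd : ∀ y, HasDerivAt (fun y => ∫ t in (0 : ℝ)..y, p t) (p y) y := fun y =>
    intervalIntegral.integral_hasDerivAt_right (hi _ _)
      hp.stronglyMeasurable.stronglyMeasurableAtFilter hp.continuousAt
  rw [e]
  exact (((hd (x + h)).comp_add_const x h).sub (hd x)).const_mul _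

/-! ### Bernstein's inequality, high frequencies and realization by polynomials. -/

namespace TorusBanachLattice

variable {X : TorusBanachLattice} {K : ℝ}

theorem SteklovBoundedBy.exists_fourierMult_bound (hK : X.SteklovBoundedBy K) {F : ℝ → ℂ}
    (hF : ContDiff ℝ 3 F) {R : ℕ} (hR : ∀ y : ℝ, (R : ℝ) < |y| → F y = 0) :
    ∃ C ≥ 0, ∀ n : ℕ, 1 ≤ n → ∀ M : ℕ, R * n ≤ M → ∀ f ∈ X.carrier,
      X.nrm (fourierMult M (fun k => F (k / n)) f) ≤ C * X.nrm f := by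
  obtain ⟨B, hB, h⟩ := exists_kernel_bound hF hR
  have h0 := hK.1
  exact ⟨8 * B * K, by positivity, fun n hn M hM f hf =>
    hK.nrm_fourierMult_le hf hB hn (h n hn M hM)⟩

/-- Bernstein's inequality. -/
theorem SteklovBoundedBy.exists_bernstein (hK : X.SteklovBoundedBy K) :
    ∃ C ≥ 0, ∀ n : ℕ, 1 ≤ n → ∀ T ∈ trigPoly n, ∀ j : ℕ,
      X.nrm (iteratedDeriv j T) ≤ (C * n) ^ j * X.nrm T := by
  obtain ⟨η, hη, hη1, hη0⟩ := exists_cutoff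
  -- On `|y| ≤ 1` the cutoff equals `1`, so on `𝒯_n` the multiplier with this symbol at `k/n` is
  -- differentiation divided by `n`.
  have hF : ContDiff ℝ 3 fun y : ℝ => Complex.I * y * η (y / 2) :=
    (contDiff_const.mul Complex.ofRealCLM.contDiff).mul
      (hη.comp (contDiff_id.div_const 2))
  obtain ⟨C, hC, h⟩ := hK.exists_fourierMult_bound hF (R := 2) (fun y hy => by
    rw [hη0, mul_zero]
    rw [abs_div, abs_two]
    push_cast at hy
    linarith)
  have key : ∀ n : ℕ, 1 ≤ n → ∀ c, X.nrm (trigSum n fun k => Complex.I * k * c k) ≤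
      (C * n) * X.nrm (trigSum n c) := fun n hn c => by
    have hn0 : (0 : ℝ) < n := by exact_mod_cast hn
    have h1 := h n hn (2 * n) le_rfl (trigSum n c) (trigSum_mem X n c)
    have e : (trigSum n fun k => Complex.I * k * c k) = (n : ℂ) • fourierMult (2 * n)
        (fun k => Complex.I * ((k / n : ℝ) : ℂ) * η (k / n / 2)) (trigSum n c) := by
      rw [fourierMult, smul_trigSum, trigSum_extend (M := 2 * n) (N := n) (by omega)]
      · refine trigSum_congr fun k hk => ?_
        have hk' : |(k : ℝ)| ≤ n := by exact_mod_cast hk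
        rw [coef_trigSum, if_pos hk, hη1]
        · have : (n : ℂ) ≠ 0 := by exact_mod_cast hn0.ne'
          push_cast
          field_simp
        · rw [abs_div, abs_div, abs_two, abs_of_pos hn0, div_div, div_le_iff₀ (by positivity)]
          linarith
      · intro k hk
        rw [coef_trigSum, if_neg (not_le.2 hk), mul_zero, mul_zero]
    rw [e, X.nrm_smul _ (fourierMult _ _ _) (trigSum_mem X _ _), Complex.norm_natCast,
      mul_comm C, mul_assoc]
    exact mul_le_mul_of_nonneg_left h1 hn0.le
  refine ⟨C, hC, fun n hn T hT j => ?_⟩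
  obtain ⟨c, rfl⟩ := mem_trigPoly_iff.1 hT
  induction j with
  | zero => simp
  | succ j ih =>
    rw [iteratedDeriv_trigSum] at ih ⊢
    have := key n hn (fun k => (Complex.I * k) ^ j * c k)
    have e : (fun k : ℤ => (Complex.I * k) ^ (j + 1) * c k) =
        fun k : ℤ => Complex.I * k * ((Complex.I * k) ^ j * c k) := by
      funext k; ring
    rw [e, pow_succ', mul_assoc]
    exact this.trans (mul_le_mul_of_nonneg_left ih (by positivity))

/-- `Ȧ²g` is a `C¹` function with derivative `O(n‖g‖)` and no frequencies up to `ln`, so the Jackson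
estimate at level `ln` gives `‖Ȧ²g‖ ≤ ‖g‖/2` for large `l`. Two averages are needed: the first makes
`g` continuous, the second differentiable everywhere. -/
theorem SteklovBoundedBy.exists_highFrequency_bound (hK : X.SteklovBoundedBy K) {γ : ℝ}
    (hγ : 0 < γ) : ∃ l : ℕ, 1 ≤ l ∧ ∃ C ≥ 0, ∀ n : ℕ, 1 ≤ n → ∀ g ∈ X.carrier,
      (∀ k : ℤ, |k| ≤ ((l * n : ℕ) : ℤ) → coef g k = 0) →
      X.nrm g ≤ C * X.nrm (g - steklovDot (γ / n) g) := by
  obtain ⟨η, hη, hη1, hη0⟩ := exists_cutoff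
  obtain ⟨B, hB, hB'⟩ := exists_kernel_bound hη (R := 1)
    (fun y hy => hη0 y (by simpa using hy.le))
  have hK0 := hK.1
  -- Jackson's constant `16BK/(ln)` times the derivative bound `6K n/γ` is `96BK²/(γl)`, which must
  -- be at most `1/2`.
  obtain ⟨l, hl⟩ := exists_nat_ge (192 * B * K * K / γ + 1)
  have hl1 : (1 : ℝ) ≤ l := le_trans (by linarith [show 0 ≤ 192 * B * K * K / γ by positivity]) hl
  refine ⟨l, by exact_mod_cast hl1, 2 * (1 + 2 * K), by positivity, fun n hn g hg hcoef => ?_⟩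
  have hn0 : (0 : ℝ) < n := by exact_mod_cast hn
  set h := γ / n with hh
  have hh0 : 0 < h := by positivity
  have hgi := periodicIntegrable hg
  have hgd := hgi.steklovDot h
  have hgX := hK.nrm_steklovDot_le hg hh0
  have hshift : (fun x => steklovDot h g (x + h)) ∈ X.carrier ∧
      X.nrm (fun x => steklovDot h g (x + h)) ≤ 4 * (K * X.nrm g) :=
    hK.nrm_le_of_le_absAvg hg (by norm_num) (by positivity)
      (fun x => by rw [add_right_comm]; exact hgd.1 _)
      ((hgi.continuous_steklovDot h).comp (by fun_prop)).measurable.aemeasurable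
      (norm_steklovDot_shift_le hgi hh0)
  set G' : ℝ → ℂ := (h : ℂ)⁻¹ • ((fun x => steklovDot h g (x + h)) - steklovDot h g) with hG'
  have hsubX := X.carrier.sub_mem hshift.1 hgX.1
  have hG'X : G' ∈ X.carrier := X.carrier.smul_mem _ hsubX
  have hG'n : X.nrm G' ≤ h⁻¹ * (6 * (K * X.nrm g)) := by
    rw [hG', X.nrm_smul _ _ hsubX, norm_inv, Complex.norm_real, Real.norm_of_nonneg hh0.le]
    gcongr
    exact (nrm_sub_le hshift.1 hgX.1).trans (by linarith [hshift.2, hgX.2])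
  have hl0 : 1 ≤ l * n := Nat.one_le_iff_ne_zero.2
    (Nat.mul_ne_zero (by rintro rfl; norm_num at hl1) (by omega))
  set G := steklovDot h (steklovDot h g) with hG
  have hzero : fourierMult (l * n) (fun k => η (k / (l * n : ℕ))) G = 0 := by
    have e : fourierMult (l * n) (fun k => η (k / (l * n : ℕ))) G = trigSum (l * n) 0 :=
      trigSum_congr fun k hk => by
        rw [hG, coef_steklovDot hgd hh0, coef_steklovDot hgi hh0, hcoef k hk]
        simp
    rw [e]
    funext x
    simp [trigSum]
  have hJ := hK.nrm_sub_fourierMult_le (G := G) (G' := G') (M := l * n)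
    (c := fun k => η (k / (l * n : ℕ)))
    (fun y => hasDerivAt_steklovDot (hgi.continuous_steklovDot h) h y)
    (hgd.steklovDot h).1 hG'X (by
      show η (((0 : ℤ) : ℝ) / ((l * n : ℕ) : ℝ)) = 1
      exact hη1 _ (by simp)) hB hl0
    (hB' (l * n) hl0 (l * n) (by simp))
  rw [hzero, sub_zero] at hJ
  have hGn : X.nrm G ≤ 1 / 2 * X.nrm g := by
    refine hJ.trans ?_
    have hg0 := X.nrm_nonneg g hg
    calc _ ≤ 16 * B * K / (l * n : ℕ) * (h⁻¹ * (6 * (K * X.nrm g))) := by gcongr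
      _ = (192 * B * K * K / γ) / (2 * l) * X.nrm g := by
        rw [hh]; push_cast; field_simp; ring
      _ ≤ _ := by
        refine mul_le_mul_of_nonneg_right ?_ hg0
        rw [div_le_div_iff₀ (by linarith) (by norm_num)]
        linarith
  set u := g - steklovDot h g with hu
  have huX : u ∈ X.carrier := X.carrier.sub_mem hg hgX.1
  have hudX := hK.nrm_steklovDot_le huX hh0
  have hGX : G ∈ X.carrier := (hK.nrm_steklovDot_le hgX.1 hh0).1
  -- The identity `I = Ȧ² + (I + Ȧ)(I - Ȧ)`; the first term will be absorbed in the left side.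
  have hsum : g = G + (u + steklovDot h u) := by
    rw [hu, steklovDot_sub hgi hgd]
    abel
  have h1 := X.nrm_add_le G hGX _ (X.carrier.add_mem huX hudX.1)
  have h2 := X.nrm_add_le u huX _ hudX.1
  rw [← hsum] at h1
  linarith [hudX.2]

theorem SteklovBoundedBy.exists_highFrequency_bound_pow (hK : X.SteklovBoundedBy K) {γ : ℝ}
    (hγ : 0 < γ) (s : ℕ) : ∃ l : ℕ, 1 ≤ l ∧ ∃ C ≥ 0, ∀ n : ℕ, 1 ≤ n → ∀ g ∈ X.carrier,
      (∀ k : ℤ, |k| ≤ ((l * n : ℕ) : ℤ) → coef g k = 0) →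
      X.nrm g ≤ C * X.nrm (subSteklovDotPow (γ / n) s g) := by
  obtain ⟨l, hl, C, hC, h⟩ := hK.exists_highFrequency_bound hγ
  refine ⟨l, hl, C ^ s, by positivity, fun n hn g hg hcoef => ?_⟩
  have hh : 0 < γ / n := div_pos hγ (by exact_mod_cast hn)
  clear hl
  induction s with
  | zero => simp [subSteklovDotPow]
  | succ s ih =>
    have h1 := h n hn _ (hK.nrm_subSteklovDotPow_le hg hh s).1 fun k hk => by
      rw [coef_subSteklovDotPow (periodicIntegrable hg) hh, hcoef k hk, mul_zero]
    rw [← subSteklovDotPow_succ] at h1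
    rw [pow_succ, mul_assoc]
    exact ih.trans (mul_le_mul_of_nonneg_left h1 (by positivity))

/-- Every `f` has a trigonometric polynomial nearby whose distance to `f` and whose `s`-th
derivative are controlled by the Steklov differences of `f`. -/
theorem SteklovBoundedBy.exists_realization (hK : X.SteklovBoundedBy K) {γ : ℝ} (hγ : 0 < γ)
    (s : ℕ) : ∃ C ≥ 0, ∀ n : ℕ, 1 ≤ n → ∀ f ∈ X.carrier, ∃ T ∈ trigPoly n,
      X.nrm (f - T) ≤ C * X.nrm (subSteklovDotPow (γ / n) s f) ∧
      X.nrm (iteratedDeriv s T) ≤ C * n ^ s * X.nrm (subSteklovDotPow (γ / n) s f) := by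
  obtain ⟨η, hη, hη1, hη0⟩ := exists_cutoff
  obtain ⟨l, hl, C₀, hC₀, hhigh⟩ := hK.exists_highFrequency_bound_pow hγ s
  have hl0 : (0 : ℝ) < l := by exact_mod_cast hl
  have hl1 : (1 : ℝ) ≤ l := by exact_mod_cast hl
  have hγ' : (γ : ℂ) ≠ 0 := by exact_mod_cast hγ.ne'
  obtain ⟨C₁, hC₁, hη_bdd⟩ := hK.exists_fourierMult_bound hη (R := 1)
    (fun y hy => hη0 y (by simpa using hy.le))
  -- The symbol of `(n⁻¹ d/dx)ˢ` divided by that of `(I - Ȧ)ˢ`; the zeros at the origin have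
  -- cancelled, so it is smooth.
  set D : ℝ → ℂ := fun y => (-(γ * symbolQuotient γ y))⁻¹ ^ s with hD
  have hDc : ContDiff ℝ 3 D := by
    refine ContDiff.pow (ContDiff.inv ?_ fun y => ?_) s
    · exact (contDiff_const.mul (contDiff_symbolQuotient γ)).neg
    · exact neg_ne_zero.2 (mul_ne_zero hγ' (symbolQuotient_ne_zero γ y))
  have hDsymb : ∀ n : ℕ, 1 ≤ n → ∀ k : ℤ,
      D (k / n) * (1 - steklovSymbol (γ / n) k) ^ s = (Complex.I * (k / n : ℝ)) ^ s := by
    intro n hn k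
    rw [one_sub_steklovSymbol_div hγ hn, hD, ← mul_pow]
    congr 1
    have := symbolQuotient_ne_zero γ (k / n)
    field_simp
  obtain ⟨C₂, hC₂, hN⟩ := hK.exists_fourierMult_bound (hη.mul hDc) (R := 1) (fun y hy => by
    rw [hη0 y (by simpa using hy.le), zero_mul])
  -- The multiplier carrying `(I - Ȧ)ˢ f` to `W - T`, the middle frequencies of `f`. The inverse
  -- symbol is singular only at `0`, and the two cutoffs agree near `0`.
  set F : ℝ → ℂ := fun y => (η (y / (2 * l)) - η y) * (D y * (Complex.I * y)⁻¹ ^ s) with hF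
  have hFc : ContDiff ℝ 3 F := by
    rw [contDiff_iff_contDiffAt]
    intro y
    rcases eq_or_ne y 0 with rfl | hy
    · refine (contDiffAt_const (c := (0 : ℂ))).congr_of_eventuallyEq ?_
      filter_upwards [Metric.ball_mem_nhds (0 : ℝ) (by norm_num : (0 : ℝ) < 1 / 2)] with y hy
      rw [Metric.mem_ball, Real.dist_eq, sub_zero] at hy
      have h1 : |y / (2 * l)| ≤ 1 / 2 := by
        rw [abs_div, abs_of_pos (by positivity : (0 : ℝ) < 2 * l), div_le_iff₀ (by positivity)]
        linarith
      rw [hF]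
      simp only
      rw [hη1 _ h1, hη1 _ hy.le, sub_self, zero_mul]
    · refine ContDiffAt.mul ?_ (hDc.contDiffAt.mul (ContDiffAt.pow (ContDiffAt.inv ?_ ?_) s))
      · exact ((hη.comp (contDiff_id.div_const (2 * (l : ℝ)))).sub hη).contDiffAt
      · exact (contDiff_const.mul Complex.ofRealCLM.contDiff).contDiffAt
      · simp [hy]
  obtain ⟨C₃, hC₃, hFb⟩ := hK.exists_fourierMult_bound hFc (R := 2 * l) (fun y hy => by
    push_cast at hy
    have h1 : 1 ≤ |y / (2 * l)| := by
      rw [abs_div, abs_of_pos (by positivity : (0 : ℝ) < 2 * l), le_div_iff₀ (by positivity)]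
      linarith
    rw [hF]
    simp only
    rw [hη0 _ h1, hη0 y (by linarith), sub_zero, zero_mul])
  refine ⟨C₀ * (1 + C₁) + C₃ + C₂, by positivity, fun n hn f hf => ?_⟩
  have hn0 : (0 : ℝ) < n := by exact_mod_cast hn
  have hh : 0 < γ / n := by positivity
  have hfi := periodicIntegrable hf
  set u := subSteklovDotPow (γ / n) s f with hu
  have huX : u ∈ X.carrier := (hK.nrm_subSteklovDotPow_le hf hh s).1
  have hu0 := X.nrm_nonneg u huX
  have hcoefu : ∀ k, coef u k = (1 - steklovSymbol (γ / n) k) ^ s * coef f k :=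
    coef_subSteklovDotPow hfi hh s
  set T := fourierMult n (fun k => η (k / n)) f with hT
  -- The cutoff at `2ln` equals `1` up to `ln`, so `f - W` has no frequencies up to `ln`, as the
  -- high-frequency bound requires.
  set W := fourierMult (2 * l * n) (fun k => η (k / (2 * l * n : ℕ))) f with hW
  have hWX : W ∈ X.carrier := trigSum_mem X _ _
  have hTX : T ∈ X.carrier := trigSum_mem X _ _
  have hgX : f - W ∈ X.carrier := X.carrier.sub_mem hf hWX
  have h2ln : 1 ≤ 2 * l * n := Nat.one_le_iff_ne_zero.2
    (Nat.mul_ne_zero (by omega) (by omega))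
  have hg : X.nrm (f - W) ≤ C₀ * ((1 + C₁) * X.nrm u) := by
    refine (hhigh n hn (f - W) hgX fun k hk => ?_).trans ?_
    · have hk' : |(k : ℝ)| ≤ l * n := by exact_mod_cast hk
      rw [hW, fourierMult, coef_sub hfi (periodicIntegrable_trigSum _ _), coef_trigSum, if_pos,
        hη1, one_mul, sub_self]
      · push_cast
        rw [abs_div, abs_of_pos (by positivity : (0 : ℝ) < 2 * l * n), div_le_iff₀ (by positivity)]
        linarith
      · push_cast at hk ⊢
        have : (0 : ℤ) ≤ l * n := by positivity
        linarith
    · refine mul_le_mul_of_nonneg_left ?_ hC₀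
      have e : subSteklovDotPow (γ / n) s W =
          fourierMult (2 * l * n) (fun k => η (k / (2 * l * n : ℕ))) u := by
        rw [hW, fourierMult, subSteklovDotPow_trigSum, fourierMult]
        congr 1
        funext k
        rw [hcoefu]
        ring
      rw [subSteklovDotPow_sub hfi (periodicIntegrable hWX), e]
      have h1 := hη_bdd (2 * l * n) h2ln (2 * l * n) (by simp) u huX
      refine (nrm_sub_le (g := fourierMult _ _ _) huX (trigSum_mem X _ _)).trans ?_
      linarith
  have hWT : X.nrm (W - T) ≤ C₃ * X.nrm u := by
    have e : W - T = fourierMult (2 * l * n) (fun k => F (k / n)) u := by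
      have hTe : T = trigSum (2 * l * n) fun k => η (k / n) * coef f k := by
        rw [hT, fourierMult]
        refine (trigSum_extend (Nat.le_mul_of_pos_left n (by omega)) fun k hk => ?_).symm
        rw [hη0, zero_mul]
        rw [abs_div, abs_of_pos hn0, le_div_iff₀ hn0, one_mul]
        exact_mod_cast hk.le
      rw [hTe, hW, fourierMult, trigSum_sub, fourierMult]
      congr 1
      funext k
      rw [hcoefu, hF]
      simp only
      have e1 : (k / n / (2 * l) : ℝ) = k / (2 * l * n : ℕ) := by
        push_cast; field_simp
      rw [e1, ← sub_mul]
      rcases eq_or_ne k 0 with rfl | hk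
      · simp
      · have h1 := hDsymb n hn k
        have h2 : (Complex.I * ((k / n : ℝ) : ℂ)) ≠ 0 := by
          simp [hk, show n ≠ 0 by omega]
        have h3 : D (k / n) * (Complex.I * ((k / n : ℝ) : ℂ))⁻¹ ^ s *
            (1 - steklovSymbol (γ / n) k) ^ s = 1 := by
          rw [mul_right_comm, h1, ← mul_pow, mul_inv_cancel₀ h2, one_pow]
        linear_combination (-(η (k / (2 * l * n : ℕ)) - η (k / n)) * coef f k) * h3
    rw [e]
    exact hFb n hn (2 * l * n) le_rfl u huX
  refine ⟨T, mem_trigPoly_iff.2 ⟨_, rfl⟩, ?_, ?_⟩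
  · have e : f - T = (f - W) + (W - T) := by abel
    rw [e]
    refine (X.nrm_add_le _ hgX _ (X.carrier.sub_mem hWX hTX)).trans ?_
    have := mul_nonneg hC₂ hu0
    linarith
  · have e : iteratedDeriv s T =
        ((n : ℂ) ^ s) • fourierMult n (fun k => η (k / n) * D (k / n)) u := by
      rw [hT, fourierMult, iteratedDeriv_trigSum, fourierMult, smul_trigSum]
      congr 1
      funext k
      rw [hcoefu]
      have h1 := hDsymb n hn k
      have h2 : (Complex.I * (k : ℂ)) ^ s = (n : ℂ) ^ s * (Complex.I * ((k / n : ℝ) : ℂ)) ^ s := by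
        have : (n : ℂ) ≠ 0 := by exact_mod_cast hn0.ne'
        rw [← mul_pow]
        congr 1
        push_cast
        field_simp
      rw [h2, ← h1]
      ring
    rw [e, X.nrm_smul _ (fourierMult _ _ _) (trigSum_mem X _ _), norm_pow, Complex.norm_natCast]
    have h1 := hN n hn n (by simp) u huX
    have h2 : C₂ * X.nrm u ≤ (C₀ * (1 + C₁) + C₃ + C₂) * X.nrm u := by
      refine mul_le_mul_of_nonneg_right ?_ hu0
      have : 0 ≤ C₀ * (1 + C₁) := by positivity
      linarith
    calc _ ≤ (n : ℝ) ^ s * ((C₀ * (1 + C₁) + C₃ + C₂) * X.nrm u) := by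
          gcongr
          exact h1.trans h2
      _ = _ := by ring

end TorusBanachLattice

/-! ### Step functions of samples and the discrete norm. -/

theorem PeriodicIntegrable.periodic_absAvg {f : ℝ → ℂ} (hf : PeriodicIntegrable f) (a : ℝ) :
    Function.Periodic (absAvg a f) (2 * Real.pi) := fun x => by
  have := (hf.norm.steklov a).1 x
  rw [steklov_norm, steklov_norm] at this
  exact_mod_cast this

/-- The periodic set covered by the translates of `[a, b)` by multiples of `2π`. -/
def periodicIco (a b : ℝ) : Set ℝ :=
  ⋃ j : ℤ, Ico (a + j * (2 * Real.pi)) (b + j * (2 * Real.pi))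

theorem add_two_pi_mem_periodicIco {a b t : ℝ} :
    t + 2 * Real.pi ∈ periodicIco a b ↔ t ∈ periodicIco a b := by
  simp only [periodicIco, mem_iUnion, mem_Ico]
  constructor
  · rintro ⟨j, h1, h2⟩
    refine ⟨j - 1, ?_, ?_⟩ <;> push_cast <;> linarith
  · rintro ⟨j, h1, h2⟩
    refine ⟨j + 1, ?_, ?_⟩ <;> push_cast <;> linarith

theorem measurableSet_periodicIco (a b : ℝ) : MeasurableSet (periodicIco a b) :=
  MeasurableSet.iUnion fun _ => measurableSet_Ico

theorem sampleStep_eq (m : ℕ) (x : ℕ → ℝ) (f : ℝ → ℂ) (t : ℝ) :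
    sampleStep m x f t = ((∑ k ∈ Finset.range m,
      (periodicIco (x k) (x (k + 1))).indicator (fun _ => ‖f (x k)‖) t : ℝ) : ℂ) := by
  rw [sampleStep, Complex.ofReal_sum]
  refine Finset.sum_congr rfl fun k _ => ?_
  by_cases h : t ∈ periodicIco (x k) (x (k + 1))
  · rw [indicator_of_mem h, indicator_of_mem (by exact h)]
  · rw [indicator_of_notMem h, indicator_of_notMem (by exact h), Complex.ofReal_zero]

theorem sum_indicator_nonneg (m : ℕ) (x : ℕ → ℝ) (f : ℝ → ℂ) (t : ℝ) :
    0 ≤ ∑ k ∈ Finset.range m,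
      (periodicIco (x k) (x (k + 1))).indicator (fun _ => ‖f (x k)‖) t :=
  Finset.sum_nonneg fun _ _ => indicator_nonneg (fun _ _ => norm_nonneg _) _

theorem norm_sampleStep (m : ℕ) (x : ℕ → ℝ) (f : ℝ → ℂ) (t : ℝ) :
    ‖sampleStep m x f t‖ = ∑ k ∈ Finset.range m,
      (periodicIco (x k) (x (k + 1))).indicator (fun _ => ‖f (x k)‖) t := by
  rw [sampleStep_eq, Complex.norm_real, Real.norm_of_nonneg (sum_indicator_nonneg m x f t)]

theorem periodic_sampleStep (m : ℕ) (x : ℕ → ℝ) (f : ℝ → ℂ) :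
    Function.Periodic (sampleStep m x f) (2 * Real.pi) := fun t => by
  rw [sampleStep_eq, sampleStep_eq]
  congr 1
  refine Finset.sum_congr rfl fun k _ => ?_
  by_cases h : t ∈ periodicIco (x k) (x (k + 1))
  · rw [indicator_of_mem h, indicator_of_mem (add_two_pi_mem_periodicIco.2 h)]
  · rw [indicator_of_notMem h, indicator_of_notMem (mt add_two_pi_mem_periodicIco.1 h)]

theorem measurable_sampleStep (m : ℕ) (x : ℕ → ℝ) (f : ℝ → ℂ) : Measurable (sampleStep m x f) :=
  Finset.measurable_fun_sum _ fun k _ =>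
    measurable_const.indicator (measurableSet_periodicIco (x k) (x (k + 1)))

theorem norm_sampleStep_sub_le (m : ℕ) (x : ℕ → ℝ) (f g : ℝ → ℂ) (t : ℝ) :
    ‖sampleStep m x (f - g) t‖ ≤ ‖(sampleStep m x f + sampleStep m x g) t‖ := by
  rw [Pi.add_apply, sampleStep_eq m x f, sampleStep_eq m x g, ← Complex.ofReal_add,
    Complex.norm_real, norm_sampleStep]
  refine le_trans ?_ (le_abs_self _)
  rw [← Finset.sum_add_distrib]
  refine Finset.sum_le_sum fun k _ => ?_
  by_cases h : t ∈ periodicIco (x k) (x (k + 1))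
  · simp only [indicator_of_mem h, Pi.sub_apply]
    exact norm_sub_le _ _
  · simp only [indicator_of_notMem h, add_zero, le_refl]

/-- A pointwise bound on each sampling interval bounds the step function. -/
theorem norm_sampleStep_le {m : ℕ} {x : ℕ → ℝ} (hwrap : x m = 2 * Real.pi + x 0)
    (hstep : ∀ k < m, x k ≤ x (k + 1)) {f : ℝ → ℂ} {B : ℝ → ℝ} (hB0 : ∀ t, 0 ≤ B t)
    (hBp : Function.Periodic B (2 * Real.pi))
    (hB : ∀ k < m, ∀ y ∈ Ico (x k) (x (k + 1)), ‖f (x k)‖ ≤ B y) (t : ℝ) :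
    ‖sampleStep m x f t‖ ≤ B t := by
  have hmono : ∀ i j, i ≤ j → j ≤ m → x i ≤ x j := fun i j hij => by
    induction j, hij using Nat.le_induction with
    | base => exact fun _ => le_rfl
    | succ j _ ih => exact fun h => (ih (by omega)).trans (hstep j (by omega))
  have hpi := Real.pi_pos
  rw [norm_sampleStep]
  by_cases hex : ∃ k < m, t ∈ periodicIco (x k) (x (k + 1))
  · obtain ⟨k, hk, ht⟩ := hex
    rw [Finset.sum_eq_single_of_mem k (Finset.mem_range.2 hk), indicator_of_mem ht]
    · obtain ⟨j, hj⟩ := mem_iUnion.1 ht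
      have := hBp.sub_int_mul_eq (x := t) j
      rw [← this]
      exact hB k hk _ ⟨by linarith [hj.1], by linarith [hj.2]⟩
    · intro k' hk' hne
      have hk' := Finset.mem_range.1 hk'
      refine indicator_of_notMem (fun ht' => hne ?_) _
      obtain ⟨j, h1, h2⟩ := mem_iUnion.1 ht
      obtain ⟨j', h1', h2'⟩ := mem_iUnion.1 ht'
      have a1 := hmono 0 k (Nat.zero_le _) hk.le
      have a2 := hmono (k + 1) m hk le_rfl
      have a1' := hmono 0 k' (Nat.zero_le _) hk'.le
      have a2' := hmono (k' + 1) m hk' le_rfl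
      -- All sampling intervals lie in the single period `[x 0, x 0 + 2π)`, so the integer translate
      -- that contains `t` is determined; disjointness then follows from monotonicity of the nodes.
      have hjj : j = j' := by
        rcases lt_trichotomy j j' with h | h | h
        · have : (j : ℝ) + 1 ≤ j' := by exact_mod_cast h
          nlinarith
        · exact h
        · have : (j' : ℝ) + 1 ≤ j := by exact_mod_cast h
          nlinarith
      subst hjj
      rcases lt_trichotomy k' k with h | h | h
      · linarith [hmono (k' + 1) k h hk.le]
      · exact h
      · linarith [hmono (k + 1) k' h hk'.le]
  · push Not at hex
    rw [Finset.sum_eq_zero fun k hk => indicator_of_notMem (hex k (Finset.mem_range.1 hk)) _]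
    exact hB0 t

theorem samplingOp_sub (m : ℕ) (x : ℕ → ℝ) (φ : ℕ → ℝ → ℂ) (f g : ℝ → ℂ) :
    samplingOp m x φ (f - g) = samplingOp m x φ f - samplingOp m x φ g := by
  funext t
  simp [samplingOp, sub_mul]

namespace TorusBanachLattice

variable {X : TorusBanachLattice} {K : ℝ}

theorem sampleStep_mem (X : TorusBanachLattice) (m : ℕ) (x : ℕ → ℝ) (f : ℝ → ℂ) :
    sampleStep m x f ∈ X.carrier := by
  refine mem_of_bounded (periodic_sampleStep m x f) (measurable_sampleStep m x f).aemeasurable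
    (∑ k ∈ Finset.range m, ‖f (x k)‖) fun t => ?_
  rw [norm_sampleStep]
  exact Finset.sum_le_sum fun k _ => indicator_le_self' (fun _ _ => norm_nonneg _) _

theorem sampleNrm_nonneg (X : TorusBanachLattice) (m : ℕ) (x : ℕ → ℝ) (f : ℝ → ℂ) :
    0 ≤ X.sampleNrm m x f :=
  X.nrm_nonneg _ (X.sampleStep_mem m x f)

theorem sampleNrm_sub_le (X : TorusBanachLattice) (m : ℕ) (x : ℕ → ℝ) (f g : ℝ → ℂ) :
    X.sampleNrm m x (f - g) ≤ X.sampleNrm m x f + X.sampleNrm m x g := by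
  have hf := X.sampleStep_mem m x f
  have hg := X.sampleStep_mem m x g
  exact (X.lattice _ _ (periodic_sampleStep m x _) (measurable_sampleStep m x _).aemeasurable
    (X.carrier.add_mem hf hg) (Eventually.of_forall (norm_sampleStep_sub_le m x f g))).2.trans
    (X.nrm_add_le _ hf _ hg)

theorem sampleNrm_neg (X : TorusBanachLattice) (m : ℕ) (x : ℕ → ℝ) (f : ℝ → ℂ) :
    X.sampleNrm m x (-f) = X.sampleNrm m x f := by
  have : sampleStep m x (-f) = sampleStep m x f := by
    funext t
    simp [sampleStep]
  rw [sampleNrm, this, sampleNrm]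

theorem sampleNrm_add_le (X : TorusBanachLattice) (m : ℕ) (x : ℕ → ℝ) (f g : ℝ → ℂ) :
    X.sampleNrm m x (f + g) ≤ X.sampleNrm m x f + X.sampleNrm m x g := by
  have := X.sampleNrm_sub_le m x f (-g)
  rwa [sub_neg_eq_add, sampleNrm_neg] at this

/-- For `y` in the interval starting at a node, the averaging window of the node lies in the window
of length `h + 2d` about `y`. Thus samples of averages are controlled by the norm of `X`, unlike
samples of `g`. -/
theorem SteklovBoundedBy.sampleNrm_steklov_le (hK : X.SteklovBoundedBy K) {m : ℕ} {x : ℕ → ℝ}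
    (hwrap : x m = 2 * Real.pi + x 0) (hstep : ∀ k < m, x k ≤ x (k + 1)) {d : ℝ} (hd : 0 < d)
    (hgap : ∀ k < m, x (k + 1) - x k ≤ d) {h : ℝ} (hh : 0 < h) {g : ℝ → ℂ} (hg : g ∈ X.carrier) :
    X.sampleNrm m x (steklov h g) ≤ (h + 2 * d) / h * (K * X.nrm g) := by
  have hgi := periodicIntegrable hg
  have ha : 0 < h + 2 * d := by positivity
  refine (hK.nrm_le_of_le_absAvg hg (by positivity) ha (periodic_sampleStep m x _)
    (measurable_sampleStep m x _).aemeasurable (norm_sampleStep_le hwrap hstep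
      (fun t => mul_nonneg (by positivity) (absAvg_nonneg ha g t))
      (fun t => by rw [hgi.periodic_absAvg]) fun k hk y hy => ?_)).2
  have := hgap k hk
  exact norm_steklov_le_absAvg hgi hh (by linarith [hy.2]) (by linarith [hy.1])

theorem SteklovBoundedBy.sampleNrm_le_of_hasDerivAt (hK : X.SteklovBoundedBy K) {m : ℕ}
    {x : ℕ → ℝ} (hwrap : x m = 2 * Real.pi + x 0) (hstep : ∀ k < m, x k ≤ x (k + 1)) {d : ℝ}
    (hd : 0 < d) (hgap : ∀ k < m, x (k + 1) - x k ≤ d) {T T' : ℝ → ℂ}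
    (hT : ∀ y, HasDerivAt T (T' y) y) (hTX : T ∈ X.carrier) (hT'X : T' ∈ X.carrier) :
    X.sampleNrm m x T ≤ X.nrm T + 2 * d * (K * X.nrm T') := by
  have hTi := periodicIntegrable hTX
  have hT'i := periodicIntegrable hT'X
  have hn := nrm_norm hTX
  have ha := hK.nrm_absAvg_le hT'X (by positivity : 0 < 2 * d)
  have ha' := X.carrier.smul_mem ((2 * d : ℝ) : ℂ) ha.1
  have h1 := X.nrm_smul ((2 * d : ℝ) : ℂ) _ ha.1
  rw [Complex.norm_real, Real.norm_of_nonneg (by positivity)] at h1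
  have h2 := (X.lattice (sampleStep m x T) _ (periodic_sampleStep m x T)
    (measurable_sampleStep m x T).aemeasurable (X.carrier.add_mem hn.1 ha')
    (Eventually.of_forall fun t => ?_)).2
  · have h3 := X.nrm_add_le _ hn.1 _ ha'
    have h4 := mul_le_mul_of_nonneg_left ha.2 (by positivity : 0 ≤ 2 * d)
    exact h2.trans (h3.trans (by linarith [hn.2]))
  · have h0 : ∀ y, 0 ≤ ‖T y‖ + 2 * d * absAvg (2 * d) T' y := fun y =>
      add_nonneg (norm_nonneg _) (mul_nonneg (by positivity) (absAvg_nonneg (by positivity) T' y))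
    have h3 := norm_sampleStep_le hwrap hstep (f := T) h0
      (fun y => by simp only [hT'i.periodic_absAvg _ y, hTi.1 y]) (fun k hk y hy => ?_) t
    · refine h3.trans ?_
      have e : ((fun t => (‖T t‖ : ℂ)) + ((2 * d : ℝ) : ℂ) • fun y => (absAvg (2 * d) T' y : ℂ)) t =
          ((‖T t‖ + 2 * d * absAvg (2 * d) T' t : ℝ) : ℂ) := by
        simp
      rw [e, Complex.norm_real]
      exact le_abs_self _
    · have h5 := norm_sub_le_absAvg hT hT'i (a := 2 * d) (x := y) (y := x k) (z := y)
        (by positivity)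
        (by rw [abs_le]; constructor <;> linarith [hy.1, hy.2, hgap k hk])
        (by simp; positivity)
      have h6 := norm_sub_norm_le (T (x k)) (T y)
      linarith

/-- Telescoping gives `(I - A)ʳ g - g = -∑_{i<r} A(I - A)ⁱ g`, a sum of averages. Subtracting `g`
removes the only part whose samples the norm of `X` does not see. -/
theorem SteklovBoundedBy.sampleNrm_subSteklovPow_sub_le (hK : X.SteklovBoundedBy K) {m : ℕ}
    {x : ℕ → ℝ} {h c : ℝ} (hh : 0 < h) (hc0 : 0 ≤ c)
    (hc : ∀ g ∈ X.carrier, X.sampleNrm m x (steklov h g) ≤ c * X.nrm g) {g : ℝ → ℂ}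
    (hg : g ∈ X.carrier) (r : ℕ) : X.sampleNrm m x (subSteklovPow h r g - g) ≤
      (∑ i ∈ Finset.range r, c * (1 + K) ^ i) * X.nrm g := by
  induction r with
  | zero =>
    have : subSteklovPow h 0 g - g = 0 := sub_self g
    rw [this, sampleNrm, show sampleStep m x 0 = 0 by funext t; simp [sampleStep], X.nrm_zero]
    simp
  | succ r ih =>
    have h1 := hK.nrm_subSteklovPow_le hg hh r
    have h2 := hc _ h1.1
    have e : subSteklovPow h (r + 1) g - g =
        (subSteklovPow h r g - g) - steklov h (subSteklovPow h r g) := by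
      rw [subSteklovPow_succ]; abel
    rw [e, Finset.sum_range_succ, add_mul, mul_assoc c]
    exact (X.sampleNrm_sub_le m x _ _).trans
      (add_le_add ih (h2.trans (mul_le_mul_of_nonneg_left h1.2 hc0)))

theorem SteklovBoundedBy.nrm_sub_steklovDot_le (hK : X.SteklovBoundedBy K) {G G' : ℝ → ℂ}
    (hG : ∀ y, HasDerivAt G (G' y) y) (hGX : G ∈ X.carrier) (hG'X : G' ∈ X.carrier) {h : ℝ}
    (hh : 0 < h) : X.nrm (G - steklovDot h G) ≤ 2 * h * K * X.nrm G' := by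
  have hmem := X.carrier.sub_mem hGX (hK.nrm_steklovDot_le hGX hh).1
  refine (hK.nrm_le_of_le_absAvg hG'X (by positivity) (by positivity) (X.periodic _ hmem)
    (X.aemeasurable _ hmem) fun y =>
      norm_sub_steklovDot_le hG (periodicIntegrable hG'X) hh y).2.trans_eq ?_
  ring

theorem SteklovBoundedBy.nrm_sub_steklov_le (hK : X.SteklovBoundedBy K) {G G' G'' : ℝ → ℂ}
    (hG : ∀ y, HasDerivAt G (G' y) y) (hG' : ∀ y, HasDerivAt G' (G'' y) y) (hGX : G ∈ X.carrier)
    (hG''X : G'' ∈ X.carrier) {h : ℝ} (hh : 0 < h) :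
    X.nrm (G - steklov h G) ≤ h ^ 2 * K * X.nrm G'' := by
  have hmem := X.carrier.sub_mem hGX (hK.2 h hh _ hGX).1
  refine (hK.nrm_le_of_le_absAvg hG''X (by positivity) hh (X.periodic _ hmem)
    (X.aemeasurable _ hmem) fun y =>
      norm_sub_steklov_le hG hG' (periodicIntegrable hG''X) hh y).2.trans_eq ?_
  ring

/-- Differentiation commutes with the averages, so each factor `I - Ȧ_h` can be traded in turn for
`h` times a derivative. -/
theorem SteklovBoundedBy.nrm_subSteklovDotPow_trigSum_le (hK : X.SteklovBoundedBy K) {h : ℝ}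
    (hh : 0 < h) (n s : ℕ) (c : ℤ → ℂ) : X.nrm (subSteklovDotPow h s (trigSum n c)) ≤
      (2 * h * K) ^ s * X.nrm (iteratedDeriv s (trigSum n c)) := by
  have hK0 := hK.1
  induction s generalizing c with
  | zero => simp [subSteklovDotPow]
  | succ s ih =>
    have ih' := ih fun k => Complex.I * k * c k
    have h1 := hK.nrm_sub_steklovDot_le
      (hasDerivAt_trigSum n fun k => (1 - steklovSymbol h k) ^ s * c k)
      (trigSum_mem X n _) (trigSum_mem X n _) hh
    simp only [iteratedDeriv_trigSum, subSteklovDotPow_trigSum] at ih'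
    rw [subSteklovDotPow_succ, iteratedDeriv_trigSum, subSteklovDotPow_trigSum]
    have e1 : (fun k : ℤ => Complex.I * k * ((1 - steklovSymbol h k) ^ s * c k)) =
        fun k : ℤ => (1 - steklovSymbol h k) ^ s * (Complex.I * k * c k) := by
      funext k; ring
    have e2 : (fun k : ℤ => (Complex.I * k) ^ s * (Complex.I * k * c k)) =
        fun k : ℤ => (Complex.I * k) ^ (s + 1) * c k := by
      funext k; ring
    rw [e1] at h1
    rw [e2] at ih'
    refine h1.trans ?_
    rw [pow_succ', mul_assoc (2 * h * K)]
    exact mul_le_mul_of_nonneg_left ih' (by positivity)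

theorem SteklovBoundedBy.nrm_subSteklovPow_trigSum_le (hK : X.SteklovBoundedBy K) {h : ℝ}
    (hh : 0 < h) (n r : ℕ) (c : ℤ → ℂ) : X.nrm (subSteklovPow h r (trigSum n c)) ≤
      (h ^ 2 * K) ^ r * X.nrm (iteratedDeriv (2 * r) (trigSum n c)) := by
  have hK0 := hK.1
  induction r generalizing c with
  | zero => simp [subSteklovPow]
  | succ r ih =>
    have ih' := ih fun k => (Complex.I * k) ^ 2 * c k
    have h1 := hK.nrm_sub_steklov_le
      (hasDerivAt_trigSum n fun k => (1 - centredSymbol h k) ^ r * c k)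
      (hasDerivAt_trigSum n _) (trigSum_mem X n _) (trigSum_mem X n _) hh
    simp only [iteratedDeriv_trigSum, subSteklovPow_trigSum] at ih'
    rw [subSteklovPow_succ, iteratedDeriv_trigSum, subSteklovPow_trigSum]
    have e1 : (fun k : ℤ => Complex.I * k * (Complex.I * k * ((1 - centredSymbol h k) ^ r * c k))) =
        fun k : ℤ => (1 - centredSymbol h k) ^ r * ((Complex.I * k) ^ 2 * c k) := by
      funext k; ring
    have e2 : (fun k : ℤ => (Complex.I * k) ^ (2 * r) * ((Complex.I * k) ^ 2 * c k)) =
        fun k : ℤ => (Complex.I * k) ^ (2 * (r + 1)) * c k := by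
      funext k; ring
    rw [e1] at h1
    rw [e2] at ih'
    refine h1.trans ?_
    rw [pow_succ' (h ^ 2 * K), mul_assoc (h ^ 2 * K)]
    exact mul_le_mul_of_nonneg_left ih' (by positivity)

end TorusBanachLattice

/-! ### Estimates for polynomials, uniform in the degree. -/

namespace TorusBanachLattice

variable {X : TorusBanachLattice} {K : ℝ}

theorem trigPoly_mem (X : TorusBanachLattice) {n : ℕ} {T : ℝ → ℂ} (hT : T ∈ trigPoly n) :
    T ∈ X.carrier := by
  obtain ⟨c, rfl⟩ := mem_trigPoly_iff.1 hT
  exact trigSum_mem X n c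

/-- A Marcinkiewicz–Zygmund inequality: a sample differs from nearby values by a local integral of
`T'`, and the gap `γ'/n` cancels the factor `n` of Bernstein's inequality. -/
theorem SteklovBoundedBy.exists_sampleNrm_trigPoly_bound (hK : X.SteklovBoundedBy K) {γ' : ℝ}
    (hγ' : 0 < γ') : ∃ C ≥ 0, ∀ n : ℕ, 1 ≤ n → ∀ (m : ℕ) (x : ℕ → ℝ),
      x m = 2 * Real.pi + x 0 → (∀ k < m, x k ≤ x (k + 1)) →
      (∀ k < m, x (k + 1) - x k ≤ γ' / n) → ∀ T ∈ trigPoly n,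
      X.sampleNrm m x T ≤ C * X.nrm T := by
  have hK0 := hK.1
  obtain ⟨C, hC, h⟩ := hK.exists_bernstein
  refine ⟨1 + 2 * γ' * K * C, by positivity, fun n hn m x hwrap hstep hgap T hT => ?_⟩
  have hn0 : (0 : ℝ) < n := by exact_mod_cast hn
  have h1 := h n hn T hT 1
  obtain ⟨c, rfl⟩ := mem_trigPoly_iff.1 hT
  rw [iteratedDeriv_trigSum] at h1
  simp only [pow_one] at h1
  have h2 := hK.sampleNrm_le_of_hasDerivAt hwrap hstep (by positivity : 0 < γ' / n) hgap
    (hasDerivAt_trigSum n c) (trigSum_mem X n _) (trigSum_mem X n _)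
  refine h2.trans ?_
  calc _ ≤ X.nrm (trigSum n c) + 2 * (γ' / n) * (K * (C * n * X.nrm (trigSum n c))) := by gcongr
    _ = _ := by field_simp

/-- `(I - A)ʳ` yields `n⁻²ʳ‖T⁽²ʳ⁾‖`; Bernstein lowers the `2r` derivatives to `s`. This is where `s
≤ 2r` enters. -/
theorem SteklovBoundedBy.exists_subSteklovPow_trigPoly_bound (hK : X.SteklovBoundedBy K) {γ : ℝ}
    (hγ : 0 < γ) {r s : ℕ} (hrs : s ≤ 2 * r) : ∃ C ≥ 0, ∀ n : ℕ, 1 ≤ n → ∀ T ∈ trigPoly n,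
      X.nrm (subSteklovPow (γ / n) r T) ≤ C * ((n : ℝ) ^ s)⁻¹ * X.nrm (iteratedDeriv s T) := by
  have hK0 := hK.1
  obtain ⟨C, hC, h⟩ := hK.exists_bernstein
  refine ⟨(γ ^ 2 * K) ^ r * C ^ (2 * r - s), by positivity, fun n hn T hT => ?_⟩
  have hn0 : (0 : ℝ) < n := by exact_mod_cast hn
  obtain ⟨c, rfl⟩ := mem_trigPoly_iff.1 hT
  have h1 := hK.nrm_subSteklovPow_trigSum_le (by positivity : 0 < γ / n) n r c
  have h2 := h n hn (iteratedDeriv s (trigSum n c))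
    (mem_trigPoly_iff.2 ⟨_, iteratedDeriv_trigSum n c s⟩) (2 * r - s)
  have e : iteratedDeriv (2 * r - s) (iteratedDeriv s (trigSum n c)) =
      iteratedDeriv (2 * r) (trigSum n c) := by
    simp only [iteratedDeriv_trigSum, ← mul_assoc, ← pow_add, Nat.sub_add_cancel hrs]
  rw [e] at h2
  refine h1.trans ((mul_le_mul_of_nonneg_left h2 (by positivity)).trans_eq ?_)
  rw [mul_pow C, ← mul_assoc, div_pow, div_mul_eq_mul_div, div_pow, ← pow_mul (n : ℝ)]
  have : (n : ℝ) ^ (2 * r) = n ^ (2 * r - s) * n ^ s := by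
    rw [← pow_add, Nat.sub_add_cancel hrs]
  rw [this]
  field_simp

theorem SteklovBoundedBy.nrm_subSteklovDotPow_trigPoly_le (hK : X.SteklovBoundedBy K) {γ : ℝ}
    (hγ : 0 < γ) {n : ℕ} (hn : 1 ≤ n) (s : ℕ) {T : ℝ → ℂ} (hT : T ∈ trigPoly n) :
    X.nrm (subSteklovDotPow (γ / n) s T) ≤
      (2 * γ * K) ^ s * ((n : ℝ) ^ s)⁻¹ * X.nrm (iteratedDeriv s T) := by
  have hn0 : (0 : ℝ) < n := by exact_mod_cast hn
  obtain ⟨c, rfl⟩ := mem_trigPoly_iff.1 hT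
  refine (hK.nrm_subSteklovDotPow_trigSum_le (by positivity : 0 < γ / n) n s c).trans_eq ?_
  rw [← inv_pow, ← mul_pow]
  congr 2
  ring

end TorusBanachLattice

theorem subSteklovPow_mem_trigPoly {n : ℕ} {T : ℝ → ℂ} (hT : T ∈ trigPoly n) (h : ℝ) (r : ℕ) :
    subSteklovPow h r T ∈ trigPoly n := by
  obtain ⟨c, rfl⟩ := mem_trigPoly_iff.1 hT
  exact mem_trigPoly_iff.2 ⟨_, subSteklovPow_trigSum n c h r⟩

theorem sub_mem_trigPoly {n : ℕ} {S T : ℝ → ℂ} (hS : S ∈ trigPoly n) (hT : T ∈ trigPoly n) :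
    S - T ∈ trigPoly n := by
  obtain ⟨c, rfl⟩ := mem_trigPoly_iff.1 hS
  obtain ⟨d, rfl⟩ := mem_trigPoly_iff.1 hT
  exact mem_trigPoly_iff.2 ⟨_, trigSum_sub n c d⟩

theorem theorem3p3 (X : TorusBanachLattice) (hX : X.SteklovBounded)
    (r s : ℕ) (hr : 1 ≤ r) (hs : 1 ≤ s) (hrs : s ≤ 2 * r)
    -- for each `n ≥ 1`: nodes `x n 0, …, x n (m n - 1)` and functions `φ n 0, …, φ n (m n - 1)`
    (m : ℕ → ℕ) (x : ℕ → ℕ → ℝ) (φ : ℕ → ℕ → ℝ → ℂ)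
    (γ γ' : ℝ) (hγ : 0 < γ) (hγ' : 0 < γ')
    (hm : ∀ n : ℕ, 1 ≤ n → 1 ≤ m n)
    (hwrap : ∀ n : ℕ, 1 ≤ n → x n (m n) = 2 * Real.pi + x n 0)
    (hgap : ∀ n : ℕ, 1 ≤ n → ∀ k < m n,
      γ / n ≤ x n (k + 1) - x n k ∧ x n (k + 1) - x n k ≤ γ' / n)
    (hG : ∀ n : ℕ, 1 ≤ n → ∀ f ∈ X.carrier, samplingOp (m n) (x n) (φ n) f ∈ trigPoly n)
    (hA1 : ∃ K₁ > 0, ∀ n : ℕ, 1 ≤ n → ∀ f ∈ X.carrier,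
      X.nrm (samplingOp (m n) (x n) (φ n) f) ≤ K₁ * X.sampleNrm (m n) (x n) f)
    (hA3 : ∃ K₃ > 0, ∀ n : ℕ, 1 ≤ n → ∀ T ∈ trigPoly n,
      X.nrm (T - samplingOp (m n) (x n) (φ n) T) ≤
        K₃ * ((n : ℝ) ^ s)⁻¹ * X.nrm (iteratedDeriv s T))
    (hA4 : ∃ K₄ > 0, ∀ n : ℕ, 1 ≤ n → ∀ T ∈ trigPoly n,
      K₄ * ((n : ℝ) ^ s)⁻¹ * X.nrm (iteratedDeriv s T) ≤
        X.nrm (T - samplingOp (m n) (x n) (φ n) T)) :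
    -- all four functions whose norms are compared lie in the space
    (∀ n : ℕ, 1 ≤ n → ∀ f ∈ X.carrier,
      f - samplingOp (m n) (x n) (φ n) f ∈ X.carrier ∧
      sampleStep (m n) (x n) (f - samplingOp (m n) (x n) (φ n) f) ∈ X.carrier ∧
      subSteklovDotPow (γ / n) s f ∈ X.carrier ∧
      sampleStep (m n) (x n) (subSteklovPow (γ / n) r f) ∈ X.carrier) ∧
    ∃ C₁ > 0, ∃ C₂ > 0, ∀ n : ℕ, 1 ≤ n → ∀ f ∈ X.carrier,
      C₁ * (X.nrm (subSteklovDotPow (γ / n) s f) +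
          X.sampleNrm (m n) (x n) (subSteklovPow (γ / n) r f)) ≤
        X.nrm (f - samplingOp (m n) (x n) (φ n) f) +
          X.sampleNrm (m n) (x n) (f - samplingOp (m n) (x n) (φ n) f) ∧
      X.nrm (f - samplingOp (m n) (x n) (φ n) f) +
          X.sampleNrm (m n) (x n) (f - samplingOp (m n) (x n) (φ n) f) ≤
        C₂ * (X.nrm (subSteklovDotPow (γ / n) s f) +
          X.sampleNrm (m n) (x n) (subSteklovPow (γ / n) r f)) := by
  obtain ⟨K, hK⟩ := TorusBanachLattice.SteklovBounded.exists_bound hX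
  have hK0 := hK.1
  have hGX : ∀ n : ℕ, 1 ≤ n → ∀ f ∈ X.carrier, samplingOp (m n) (x n) (φ n) f ∈ X.carrier :=
    fun n hn f hf => X.trigPoly_mem (hG n hn f hf)
  have hh : ∀ n : ℕ, 1 ≤ n → 0 < γ / n := fun n hn => div_pos hγ (by exact_mod_cast hn)
  refine ⟨fun n hn f hf => ⟨X.carrier.sub_mem hf (hGX n hn f hf), X.sampleStep_mem _ _ _,
    (hK.nrm_subSteklovDotPow_le hf (hh n hn) s).1, X.sampleStep_mem _ _ _⟩, ?_⟩
  obtain ⟨K₁, hK₁, hA1⟩ := hA1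
  obtain ⟨K₃, hK₃, hA3⟩ := hA3
  obtain ⟨K₄, hK₄, hA4⟩ := hA4
  obtain ⟨R, hR, hreal⟩ := hK.exists_realization hγ s
  obtain ⟨S, hS, hMZ⟩ := hK.exists_sampleNrm_trigPoly_bound hγ'
  obtain ⟨P, hP, hpow⟩ := hK.exists_subSteklovPow_trigPoly_bound hγ hrs
  -- The factor `(h + 2d)/h` for `h = γ/n`, `d = γ'/n`, in which `n` cancels.
  set c : ℝ := (γ + 2 * γ') / γ * K with hc
  have hc0 : 0 ≤ c := by positivity
  set Q : ℝ := ∑ i ∈ Finset.range r, c * (1 + K) ^ i with hQ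
  have hQ0 : 0 ≤ Q := Finset.sum_nonneg fun i _ => by positivity
  set L : ℝ := (1 + 2 * K) ^ s + Q + 1 + ((2 * γ * K) ^ s + S * P) * (K₁ / K₄) with hL
  have hL0 : 0 < L := by positivity
  set U : ℝ := 1 + S * P * R + (1 + Q) * R with hU
  have hU0 : 0 ≤ U := by positivity
  set V : ℝ := (1 + S) * (R + K₃ * R + K₁ * U) + U with hV
  have hV0 : 0 ≤ V := by positivity
  refine ⟨L⁻¹, by positivity, V + 1, by positivity, fun n hn f hf => ?_⟩
  have hn0 : (0 : ℝ) < n := by exact_mod_cast hn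
  have hstep : ∀ k < m n, x n k ≤ x n (k + 1) := fun k hk => by
    have := (hgap n hn k hk).1
    linarith [hh n hn]
  have hMZ := hMZ n hn (m n) (x n) (hwrap n hn) hstep fun k hk => (hgap n hn k hk).2
  have hA1 := hA1 n hn
  have hA3 := hA3 n hn
  have hA4 := hA4 n hn
  have hsample : ∀ g ∈ X.carrier, X.sampleNrm (m n) (x n) (subSteklovPow (γ / n) r g - g) ≤
      Q * X.nrm g := fun g hg => by
    refine hK.sampleNrm_subSteklovPow_sub_le (hh n hn) hc0 (fun g hg => ?_) hg r
    refine (hK.sampleNrm_steklov_le (hwrap n hn) hstep (div_pos hγ' hn0)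
      (fun k hk => (hgap n hn k hk).2) (hh n hn) hg).trans_eq ?_
    rw [hc]
    field_simp
  have hpow := hpow n hn
  have hdot : ∀ T ∈ trigPoly n, X.nrm (subSteklovDotPow (γ / n) s T) ≤
      (2 * γ * K) ^ s * ((n : ℝ) ^ s)⁻¹ * X.nrm (iteratedDeriv s T) :=
    fun T hT => hK.nrm_subSteklovDotPow_trigPoly_le hγ hn s hT
  have hG := hG n hn
  have hGX := hGX n hn
  have hGsub := samplingOp_sub (m n) (x n) (φ n)
  set G := samplingOp (m n) (x n) (φ n)
  set N := X.sampleNrm (m n) (x n) with hN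
  set h := γ / n
  have hh := hh n hn
  have hfi := X.periodicIntegrable hf
  set ω := X.nrm (subSteklovDotPow h s f) with hω
  set b := N (subSteklovPow h r f) with hb
  have hω0 : 0 ≤ ω := X.nrm_nonneg _ (hK.nrm_subSteklovDotPow_le hf hh s).1
  have hb0 : 0 ≤ b := X.sampleNrm_nonneg _ _ _
  constructor
  · have heX := X.carrier.sub_mem hf (hGX f hf)
    set e := X.nrm (f - G f) with he
    set σ := N (f - G f) with hσ
    have he0 : 0 ≤ e := X.nrm_nonneg _ heX
    have hσ0 : 0 ≤ σ := X.sampleNrm_nonneg _ _ _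
    have hGf := hG f hf
    have hGfi := X.periodicIntegrable (hGX f hf)
    set p := ((n : ℝ) ^ s)⁻¹ * X.nrm (iteratedDeriv s (G f)) with hp
    -- (A4) for the polynomial `Gf`, then linearity, `Gf - G(Gf) = G(f - Gf)`, and (A1).
    have hpσ : p ≤ K₁ / K₄ * σ := by
      have h1 := hA4 (G f) hGf
      have h2 := hA1 _ heX
      rw [hGsub] at h2
      rw [div_mul_eq_mul_div, le_div_iff₀ hK₄]
      have : p * K₄ = K₄ * ((n : ℝ) ^ s)⁻¹ * X.nrm (iteratedDeriv s (G f)) := by rw [hp]; ring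
      rw [this]
      exact h1.trans h2
    have e1 : subSteklovDotPow h s f = subSteklovDotPow h s (f - G f) + subSteklovDotPow h s (G f) := by
      rw [subSteklovDotPow_sub hfi hGfi]; abel
    have h1 : ω ≤ (1 + 2 * K) ^ s * e + (2 * γ * K) ^ s * p := by
      have a1 := hK.nrm_subSteklovDotPow_le heX hh s
      have a2 := hK.nrm_subSteklovDotPow_le (hGX f hf) hh s
      have a3 := hdot _ hGf
      rw [hω, e1]
      refine (X.nrm_add_le _ a1.1 _ a2.1).trans (add_le_add a1.2 (a3.trans_eq ?_))
      rw [hp, mul_assoc]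
    -- Only the bare `f - Gf` needs its own discrete norm; the first bracket is made of averages and
    -- the last term is a polynomial.
    have e2 : subSteklovPow h r f = (subSteklovPow h r (f - G f) - (f - G f)) +
        ((f - G f) + subSteklovPow h r (G f)) := by
      rw [subSteklovPow_sub hfi hGfi]; abel
    have h2 : b ≤ Q * e + (σ + S * (P * p)) := by
      rw [hb, e2]
      refine (X.sampleNrm_add_le _ _ _ _).trans (add_le_add (hsample _ heX) ?_)
      refine (X.sampleNrm_add_le _ _ _ _).trans (add_le_add le_rfl ?_)
      refine (hMZ _ (subSteklovPow_mem_trigPoly hGf h r)).trans ?_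
      refine mul_le_mul_of_nonneg_left ((hpow _ hGf).trans_eq ?_) hS
      rw [hp, mul_assoc]
    rw [inv_mul_le_iff₀ hL0]
    have h3 : ((2 * γ * K) ^ s + S * P) * p ≤ ((2 * γ * K) ^ s + S * P) * (K₁ / K₄ * σ) := by
      gcongr
    have t1 : 0 ≤ (1 + 2 * K) ^ s * σ := by positivity
    have t2 : 0 ≤ Q * σ := by positivity
    have t3 : 0 ≤ ((2 * γ * K) ^ s + S * P) * (K₁ / K₄) * e := by positivity
    rw [hL]
    linarith
  · obtain ⟨T, hT, hd, hTs⟩ := hreal n hn f hf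
    have hTX := X.trigPoly_mem hT
    have hTi := X.periodicIntegrable hTX
    have hdX := X.carrier.sub_mem hf hTX
    have hTs' : ((n : ℝ) ^ s)⁻¹ * X.nrm (iteratedDeriv s T) ≤ R * ω := by
      rw [inv_mul_le_iff₀ (by positivity)]
      linarith
    have h1 : N (f - T) ≤ U * (ω + b) := by
      -- Point values of `f - T` are recovered from those of `(I - A)ʳ f`: the other terms are a
      -- polynomial and a sum of averages of `f - T`.
      have e1 : f - T = (subSteklovPow h r f - subSteklovPow h r T) -
          (subSteklovPow h r (f - T) - (f - T)) := by
        rw [subSteklovPow_sub hfi hTi]; abel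
      have a1 : N (subSteklovPow h r T) ≤ S * (P * (R * ω)) := by
        refine (hMZ _ (subSteklovPow_mem_trigPoly hT h r)).trans ?_
        refine mul_le_mul_of_nonneg_left ((hpow _ hT).trans ?_) hS
        rw [mul_assoc]
        exact mul_le_mul_of_nonneg_left hTs' hP
      have a2 : N (subSteklovPow h r (f - T) - (f - T)) ≤ Q * (R * ω) :=
        (hsample _ hdX).trans (mul_le_mul_of_nonneg_left hd hQ0)
      have a3 := X.sampleNrm_sub_le (m n) (x n) (subSteklovPow h r f) (subSteklovPow h r T)
      have a4 := X.sampleNrm_sub_le (m n) (x n) (subSteklovPow h r f - subSteklovPow h r T)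
        (subSteklovPow h r (f - T) - (f - T))
      rw [← e1] at a4
      have t1 : 0 ≤ S * P * R * b := by positivity
      have t2 : 0 ≤ (1 + Q) * R * b := by positivity
      have t3 : 0 ≤ R * ω := by positivity
      rw [hU]
      simp only [hN] at *
      linarith
    have h2 : X.nrm (T - G T) ≤ K₃ * (R * ω) := by
      refine (hA3 T hT).trans ?_
      rw [mul_assoc]
      exact mul_le_mul_of_nonneg_left hTs' hK₃.le
    have h3 : X.nrm (G (f - T)) ≤ K₁ * (U * (ω + b)) :=
      (hA1 _ hdX).trans (mul_le_mul_of_nonneg_left h1 hK₁.le)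
    have hTG := sub_mem_trigPoly hT (hG T hTX)
    have hGd := hG _ hdX
    have hTGX := X.trigPoly_mem hTG
    have hGdX := X.trigPoly_mem hGd
    have e2 : f - G f = (f - T) + ((T - G T) - G (f - T)) := by
      rw [hGsub]; abel
    have b1 : X.nrm ((T - G T) - G (f - T)) ≤ K₃ * (R * ω) + K₁ * (U * (ω + b)) :=
      (X.nrm_sub_le hTGX hGdX).trans (add_le_add h2 h3)
    -- `(T - GT) - G(f - T)` is a polynomial of degree at most `n`, so its discrete norm is bounded
    -- by its norm in `X`.
    have b2 : N ((T - G T) - G (f - T)) ≤ S * (K₃ * (R * ω) + K₁ * (U * (ω + b))) :=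
      (hMZ _ (sub_mem_trigPoly hTG hGd)).trans (mul_le_mul_of_nonneg_left b1 hS)
    have c1 := X.nrm_add_le _ hdX _ (X.carrier.sub_mem hTGX hGdX)
    have c2 := X.sampleNrm_add_le (m n) (x n) (f - T) ((T - G T) - G (f - T))
    rw [← e2] at c1 c2
    have t1 : 0 ≤ (R + K₃ * R) * b := by positivity
    have t2 : 0 ≤ S * (R * (ω + b) + K₃ * (R * b)) := by positivity
    rw [hV]
    simp only [hN] at *
    linarith
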